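/- **Theorem (Consistency of the matching quantile estimator).** *Population.* A unit has a real exposure $W$, a scalar pre-exposure covariate $C$, real potential outcomes $Y(w)$ (jointly measurable in $w$ and the unit) and an observed outcome $Y^{obs}$. Let $\mathbb W\subseteq\mathbb R$ be a non-degenerate interval, let $\mathcal C=[c_0,c_1]$ with $c_0<c_1$, and let $\mathcal I\subset\mathbb R$ be a compact interval. The conditional law of $W$ given $C=c$ has density $e(w,c)$ with respect to Lebesgue measure on $\mathbb W$. Fix regular conditional distributions of the unit given $(W,C)$ and given $C$; conditional laws below are taken from them. Put $F_w(q)=\mathbb P(Y(w)\le q)$, $F_w(q\mid w,c)=\mathbb P(Y(w)\le q\mid W=w,C=c)$ and $q_\tau(w)=\inf\{q:F_w(q)\ge\tau\}$. *Estimator.* Let $(W_j,C_j,Y_j)$, $j=1,2,\dots$, be the exposures, covariates and observed outcomes of i.i.d. units, and let $\delta=\delta_N$ be calipers with $\delta_N=o(N^{-1/3})$ and $N\delta_N\to\infty$. Fix $w\in\mathbb W$ and $\tau\in(0,1)$. Let $\mathcal L_N$ be a finite set of exposure levels that contains $w$ and whose elements are pairwise at distance at least $2\delta_N$. For $v\in\mathcal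 L_N$ and $i\le N$, the template unit $(v,C_i)$ is matched, with replacement, to the unit $j\le N$ with $W_j\in[v-\delta_N,v+\delta_N]$ that minimizes $|C_j-C_i|$ (ties go to the smallest index; there is no match if no unit has exposure in this window). Let $K_j$ be the number of times unit $j$ is used as a match over all $(v,i)$, and let $\widehat q_\tau(w)$ be any minimizer over $q\in\mathbb R$ of $$\frac1N\sum_{j=1}^N K_j\,\mathbf 1(W_j\in[w-\delta_N,w+\delta_N])\,\rho_\tau(Y_j-q),\qquad \rho_\tau(u)=u(\tau-\mathbf 1(u<0)).$$ *Assumptions.* 1. (Consistency) If $W=v\in\mathbb W$, then $Y^{obs}=Y(v)$. 2. (Overlap) $e(v,c)\ge p$ for all $v\in\mathbb W$, $c\in\mathcal C$, for some constant $p>0$. 3. (Local weak unconfoundedness) For all large $N$, all $v\in\mathbb W$, all $\tilde v\in\mathbb W\cap[v-\delta_N,v+\delta_N]$ and all $c\in\mathcal C$, the conditional law of $Y(v)$ given $C=c,\ W=\tilde v$ equals its conditional law given $C=c$. 4. (Smoothness) For every $c\in\mathcal C$, $v\mapsto e(v,c)$ is Lipschitz on $\mathbb W$; for every $q\in\mathcal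 I$, $v\mapsto F_v(q\mid v,c)$ is Lipschitz on $\mathbb W$ with a constant that does not depend on $c\in\mathcal C$. 5. (Regularity of the covariate) $C$ has a density supported on $\mathcal C$ that is bounded and bounded away from zero on $\mathcal C$; for all $q\in\mathcal I$ and $v\in\mathbb W$, $c\mapsto F_v(q\mid v,c)$ is Lipschitz on $\mathcal C$. 6. (Regularity of the outcome) $F_w$ is strictly increasing and absolutely continuous on $\mathcal I$, with a finite derivative $f_w$ that is bounded away from $0$ on $\mathcal I$, and $q_\tau(w)$ is an interior point of $\mathcal I$. *Conclusion.* $\widehat q_\tau(w)\to q_\tau(w)$ in probability as $N\to\infty$. -/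

import Mathlib

open MeasureTheory ProbabilityTheory Filter Topology Set

namespace MatchingQuantile

/-- The random quantities attached to one unit of the population: exposure `W`, scalar pre-exposure
covariate `C`, potential outcomes `Y w` (one for each exposure level `w`), observed outcome `Yobs`.
`Ω` is the space of all characteristics of a unit. -/
structure UnitModel (Ω : Type*) [MeasurableSpace Ω] where
  W : Ω → ℝ
  C : Ω → ℝ
  Y : ℝ → Ω → ℝ
  Yobs : Ω → ℝ
  measurable_W : Measurable W
  measurable_C : Measurable C
  measurable_Y : Measurable (Function.uncurry Y)
  measurable_Yobs : Measurable Yobs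

variable {Ω : Type*} [MeasurableSpace Ω]

/-! ### Population quantities -/

/-- `F_w(q) = P(Y(w) ≤ q)`. -/
noncomputable def potCDF (P : Measure Ω) (M : UnitModel Ω) (w q : ℝ) : ℝ :=
  P.real {ω | M.Y w ω ≤ q}

/-- The quantile exposure-response function `q_τ(w) = inf {q : F_w(q) ≥ τ}`. -/
noncomputable def qerf (P : Measure Ω) (M : UnitModel Ω) (τ w : ℝ) : ℝ :=
  sInf {q : ℝ | τ ≤ potCDF P M w q}

/-- `κ` is a regular conditional probability of the unit given a random element `X` of it:
`κ x` is the conditional law of the unit given `X = x`. -/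
def IsRegularCondProb {β : Type*} [MeasurableSpace β] (P : Measure Ω) (X : Ω → β)
    (κ : Kernel β Ω) : Prop :=
  (P.map X).compProd κ = P.map (fun ω => (X ω, ω))

/-- `e w c` is the conditional density at `w` (with respect to Lebesgue measure on `𝕎`) of the
exposure given `C = c`, that is, the generalized propensity score. -/
def IsGPS (P : Measure Ω) (M : UnitModel Ω) (𝕎 : Set ℝ) (e : ℝ → ℝ → ℝ) : Prop :=
  Measurable (Function.uncurry e) ∧
    P.map (fun ω => (M.W ω, M.C ω)) =
      ((volume.restrict 𝕎).prod (P.map M.C)).withDensity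
        (fun p => ENNReal.ofReal (e p.1 p.2))

/-- `F_w(q ∣ w, c) = P(Y(w) ≤ q ∣ W = w, C = c)`, where `κ` is the conditional law of the unit given
`(W, C)`. -/
noncomputable def condCDFAt (M : UnitModel Ω) (κ : Kernel (ℝ × ℝ) Ω) (q w c : ℝ) : ℝ :=
  (κ (w, c)).real {ω | M.Y w ω ≤ q}

/-! ### Assumptions -/

/-- `W = w` implies `Yobs = Y(w)`. -/
def Consistency (M : UnitModel Ω) (𝕎 : Set ℝ) : Prop :=
  ∀ w ∈ 𝕎, ∀ ω, M.W ω = w → M.Yobs ω = M.Y w ω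

/-- The generalized propensity score is bounded below by a positive constant. -/
def Overlap (𝕎 𝒞 : Set ℝ) (e : ℝ → ℝ → ℝ) : Prop :=
  ∃ p : ℝ, 0 < p ∧ ∀ w ∈ 𝕎, ∀ c ∈ 𝒞, p ≤ e w c

/-- Local weak unconfoundedness with radius `δ`: for `w'` in `[w - δ, w + δ]` the conditional law of
`Y(w)` given `C = c`, `W = w'` is its conditional law given `C = c`. Here `κ` and `η` are the
conditional laws of the unit given `(W, C)` and given `C`. -/
def LocalWeakUnconfoundedness (M : UnitModel Ω) (𝕎 𝒞 : Set ℝ) (κ : Kernel (ℝ × ℝ) Ω)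
    (η : Kernel ℝ Ω) (δ : ℝ) : Prop :=
  ∀ w ∈ 𝕎, ∀ w' ∈ 𝕎 ∩ Icc (w - δ) (w + δ), ∀ c ∈ 𝒞,
    (κ (w', c)).map (M.Y w) = (η c).map (M.Y w)

/-- Smoothness in the exposure: the generalized propensity score is Lipschitz in `w` for every `c`,
and so is `F_w(q ∣ w, c)`, uniformly in `c`, for every `q` in `I`. -/
def Smoothness (M : UnitModel Ω) (𝕎 𝒞 I : Set ℝ) (e : ℝ → ℝ → ℝ) (κ : Kernel (ℝ × ℝ) Ω) : Prop :=
  (∀ c ∈ 𝒞, ∃ K, LipschitzOnWith K (fun w => e w c) 𝕎) ∧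
    ∀ q ∈ I, ∃ K, ∀ c ∈ 𝒞, LipschitzOnWith K (fun w => condCDFAt M κ q w c) 𝕎

/-- Regularity of the scalar covariate: it is continuously distributed on the compact interval
`[c₀, c₁]`, with a density bounded and bounded away from zero there, and for every `q` in `I` and
every exposure level `w`, `F_w(q ∣ w, c)` is Lipschitz in `c`. -/
def CovariateRegularity (P : Measure Ω) (M : UnitModel Ω) (𝕎 I : Set ℝ) (c₀ c₁ : ℝ)
    (κ : Kernel (ℝ × ℝ) Ω) : Prop :=
  (∃ f : ℝ → ℝ, Measurable f ∧
    P.map M.C = (volume.restrict (Icc c₀ c₁)).withDensity (fun c => ENNReal.ofReal (f c)) ∧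
    ∃ m B : ℝ, 0 < m ∧ ∀ c ∈ Icc c₀ c₁, m ≤ f c ∧ f c ≤ B) ∧
  ∀ q ∈ I, ∀ w ∈ 𝕎, ∃ K, LipschitzOnWith K (fun c => condCDFAt M κ q w c) (Icc c₀ c₁)

/-- `F_w` is strictly increasing and absolutely continuous on `[a, b]`, with a finite derivative
that is bounded away from zero there. -/
def OutcomeRegularity (P : Measure Ω) (M : UnitModel Ω) (w a b : ℝ) : Prop :=
  StrictMonoOn (potCDF P M w) (Icc a b) ∧
  AbsolutelyContinuousOnInterval (potCDF P M w) a b ∧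
  ∃ (f : ℝ → ℝ) (m : ℝ), 0 < m ∧
    ∀ q ∈ Icc a b, HasDerivWithinAt (potCDF P M w) (f q) (Icc a b) q ∧ m ≤ f q

/-! ### The matching estimator, for the units `x 0, …, x (N - 1)` -/

/-- The units with exposure in `[v - δ, v + δ]`. -/
noncomputable def caliperSet (M : UnitModel Ω) (x : ℕ → Ω) (N : ℕ) (δ v : ℝ) : Finset ℕ :=
  open Classical in (Finset.range N).filter (fun j => M.W (x j) ∈ Icc (v - δ) (v + δ))

/-- Unit `j` is the match of the template unit with covariate value `C_i` and exposure level `v`: it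
minimizes the covariate distance to `C_i` among the units with exposure in `[v - δ, v + δ]` (ties go
to the smallest index). -/
def IsMatch (M : UnitModel Ω) (x : ℕ → Ω) (N : ℕ) (δ v : ℝ) (i j : ℕ) : Prop :=
  j ∈ caliperSet M x N δ v ∧ ∀ k ∈ caliperSet M x N δ v,
    |M.C (x j) - M.C (x i)| < |M.C (x k) - M.C (x i)| ∨
      (|M.C (x j) - M.C (x i)| = |M.C (x k) - M.C (x i)| ∧ j ≤ k)

/-- `K_j`: the number of times unit `j` is used as a match, over all template units
`i = 0, …, N - 1` and all exposure levels. -/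
noncomputable def replacementCount (M : UnitModel Ω) (x : ℕ → Ω) (N : ℕ) (δ : ℝ)
    (levels : Finset ℝ) (j : ℕ) : ℕ :=
  open Classical in
  ∑ v ∈ levels, ((Finset.range N).filter (fun i => IsMatch M x N δ v i j)).card

/-- The quantile loss `ρ_τ(u) = u (τ - 1(u < 0))`. -/
noncomputable def checkLoss (τ u : ℝ) : ℝ := u * (τ - if u < 0 then 1 else 0)

/-- The objective function `N⁻¹ ∑ⱼ K_j 1(W_j ∈ [w - δ, w + δ]) ρ_τ(Y_j - q)`. -/
noncomputable def objective (M : UnitModel Ω) (x : ℕ → Ω) (N : ℕ) (δ : ℝ) (levels : Finset ℝ)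
    (τ w q : ℝ) : ℝ :=
  (1 / (N : ℝ)) * ∑ j ∈ caliperSet M x N δ w,
    (replacementCount M x N δ levels j : ℝ) * checkLoss τ (M.Yobs (x j) - q)

end MatchingQuantile

/-! The estimator is a weighted `τ`-quantile, so it lies between any two points at which the
weighted distribution function of the matched outcomes is below and above `τ`
(`mem_Icc_of_isMinOn_objective`). It therefore suffices that this function converges in probability
to `F_w` at two points, one on each side of `q_τ(w)` and close to it. Other exposure levels do not
interfere: their windows meet that of `w` at most at endpoints, which have probability zero.

The convergence (`tendstoInMeasure_matchedCDF`) splits each indicator into its conditional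
probability given `(W, C)` and a residual. The match counts depend on exposures and covariates only,
so the weighted residuals are uncorrelated and their sum has second moment at most the sum of
squared weights, hence at most the largest weight. The remaining term averages `F_{W_j}(q ∣ W_j,
C_j)` over the matches `j` of the units `i`. By the Lipschitz conditions it is close to the average
of `F_w(q ∣ w, C_i)`, which by unconfoundedness is `P(Y(w) ≤ q ∣ C_i)`; the law of large numbers
then gives `F_w(q)`.

Both terms need close matches and small weights (`tendsto_measure_not_goodMatching`). The covariate
interval is cut into finitely many short bins. By overlap and `N δ_N → ∞`, each bin eventually
contains a unit in the exposure window, so matches are close; a unit then serves only neighbours,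
whose share is small because the covariate density is bounded. -/

namespace MatchingQuantile

variable {Ω : Type*} [MeasurableSpace Ω]

/-! ### Conditional residuals and a second-moment bound -/

section Independence

variable {β S : Type*} [MeasurableSpace β] [MeasurableSpace S]

/-- The deviation of the indicator of `A` from its conditional probability given `X`. -/
noncomputable def condResidual (X : Ω → β) (κ : Kernel β Ω) (A : Set Ω) (ω : Ω) : ℝ :=
  A.indicator 1 ω - (κ (X ω)).real A

lemma measurable_kernel_real (κ : Kernel β Ω) {A : Set Ω} (hA : MeasurableSet A) :
    Measurable fun b => (κ b).real A :=
  (κ.measurable_coe hA).ennreal_toReal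

lemma measurable_condResidual {X : Ω → β} (hX : Measurable X) (κ : Kernel β Ω) {A : Set Ω}
    (hA : MeasurableSet A) : Measurable (condResidual X κ A) :=
  (measurable_one.indicator hA).sub ((measurable_kernel_real κ hA).comp hX)

lemma abs_condResidual_le (X : Ω → β) (κ : Kernel β Ω) [IsMarkovKernel κ] (A : Set Ω) (ω : Ω) :
    |condResidual X κ A ω| ≤ 1 := by
  have h0 : 0 ≤ (κ (X ω)).real A := measureReal_nonneg
  have h1 : (κ (X ω)).real A ≤ 1 := measureReal_le_one
  unfold condResidual
  by_cases h : ω ∈ A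
  · simp only [indicator_of_mem h, Pi.one_apply]
    exact abs_le.2 ⟨by linarith, by linarith⟩
  · simp only [indicator_of_notMem h]
    exact abs_le.2 ⟨by linarith, by linarith⟩

/-- Both sides integrate the same bounded function against the joint law of `(X ω, ω)`, which the
regular conditional probability disintegrates. -/
lemma integral_indicator_eq_integral_kernel {P : Measure Ω} [IsProbabilityMeasure P] {X : Ω → β}
    (hX : Measurable X) {κ : Kernel β Ω} [IsMarkovKernel κ] (hκ : IsRegularCondProb P X κ)
    {A : Set Ω} (hA : MeasurableSet A) {φ : β → ℝ} (hφ : Measurable φ) {b : ℝ}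
    (hb : ∀ x, |φ x| ≤ b) :
    ∫ ω, φ (X ω) * A.indicator 1 ω ∂P = ∫ ω, φ (X ω) * (κ (X ω)).real A ∂P := by
  have := Measure.isProbabilityMeasure_map (μ := P) hX.aemeasurable
  have hm : Measurable fun p : β × Ω => φ p.1 * A.indicator (1 : Ω → ℝ) p.2 :=
    (hφ.comp measurable_fst).mul ((measurable_one.indicator hA).comp measurable_snd)
  have hind : ∀ ω, |A.indicator (1 : Ω → ℝ) ω| ≤ 1 := fun ω => by
    by_cases h : ω ∈ A <;> simp [h]
  have e1 : ∫ ω, φ (X ω) * A.indicator 1 ω ∂P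
      = ∫ p, φ p.1 * A.indicator 1 p.2 ∂(P.map fun ω => (X ω, ω)) := by
    rw [integral_map (hX.prodMk measurable_id').aemeasurable hm.aestronglyMeasurable]
  rw [e1, ← hκ, Measure.integral_compProd]
  · rw [integral_map hX.aemeasurable]
    · refine integral_congr_ae (ae_of_all _ fun ω => ?_)
      simp only [integral_const_mul, integral_indicator_one hA]
    · simp only [integral_const_mul, integral_indicator_one hA]
      exact (hφ.mul (measurable_kernel_real κ hA)).aestronglyMeasurable
  · refine Integrable.of_bound hm.aestronglyMeasurable b (ae_of_all _ fun p => ?_)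
    rw [Real.norm_eq_abs, abs_mul]
    have := mul_le_mul (hb p.1) (hind p.2) (abs_nonneg _) ((abs_nonneg _).trans (hb p.1))
    simpa using this

lemma integral_mul_condResidual {P : Measure Ω} [IsProbabilityMeasure P] {X : Ω → β}
    (hX : Measurable X) {κ : Kernel β Ω} [IsMarkovKernel κ] (hκ : IsRegularCondProb P X κ)
    {A : Set Ω} (hA : MeasurableSet A) {φ : β → ℝ} (hφ : Measurable φ) {b : ℝ}
    (hb : ∀ x, |φ x| ≤ b) :
    ∫ ω, φ (X ω) * condResidual X κ A ω ∂P = 0 := by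
  have bound : ∀ f : Ω → ℝ, Measurable f → (∀ ω, |f ω| ≤ 1) →
      Integrable (fun ω => φ (X ω) * f ω) P := fun f hf hf1 => by
    refine Integrable.of_bound ((hφ.comp hX).mul hf).aestronglyMeasurable b
      (ae_of_all _ fun ω => ?_)
    rw [Real.norm_eq_abs, abs_mul]
    have := mul_le_mul (hb (X ω)) (hf1 ω) (abs_nonneg _) ((abs_nonneg _).trans (hb (X ω)))
    simpa using this
  simp only [condResidual, mul_sub]
  rw [integral_sub, integral_indicator_eq_integral_kernel hX hκ hA hφ hb, sub_self]
  · refine bound _ (measurable_one.indicator hA) fun ω => ?_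
    by_cases h : ω ∈ A <;> simp [h]
  · refine bound _ ((measurable_kernel_real κ hA).comp hX) fun ω => ?_
    rw [abs_of_nonneg measureReal_nonneg]
    exact measureReal_le_one

lemma indepFun_coordinate_rest {μ : Measure S} {U : ℕ → S → Ω} (hU : ∀ j, Measurable (U j))
    (hind : iIndepFun U μ) (j : ℕ) :
    IndepFun (U j) (fun s (k : {k : ℕ // k ≠ j}) => U k s) μ := by
  have h := indep_iSup_of_disjoint (fun k => (hU k).comap_le) hind
    (S := {j}) (T := {k | k ≠ j}) (by simp)
  rw [IndepFun_iff_Indep]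
  refine indep_of_indep_of_le_left (indep_of_indep_of_le_right h ?_) ?_
  · rw [MeasurableSpace.pi, MeasurableSpace.comap_iSup]
    refine iSup_le fun k => ?_
    rw [MeasurableSpace.comap_comp]
    exact le_iSup₂_of_le k.1 k.2 le_rfl
  · exact le_iSup₂_of_le j rfl le_rfl

/-- Freeze all units but the `j`-th: what multiplies its residual is then a bounded function of `X
(U j)` alone, so integrating over that unit gives zero. The weight `H` may depend on the
conditioning variables of every unit, including `j`. -/
lemma integral_mul_condResidual_mul_condResidual {P : Measure Ω} [IsProbabilityMeasure P]
    {X : Ω → β} (hX : Measurable X) {κ : Kernel β Ω} [IsMarkovKernel κ]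
    (hκ : IsRegularCondProb P X κ) {A : Set Ω} (hA : MeasurableSet A)
    {μ : Measure S} [IsProbabilityMeasure μ] {U : ℕ → S → Ω} (hU : ∀ j, Measurable (U j))
    (hlaw : ∀ j, μ.map (U j) = P) (hind : iIndepFun U μ)
    {H : (ℕ → β) → ℝ} (hH : Measurable H) {b : ℝ} (hb : ∀ z, |H z| ≤ b) {j l : ℕ} (hjl : j ≠ l) :
    ∫ s, H (fun k => X (U k s)) * condResidual X κ A (U j s) * condResidual X κ A (U l s) ∂μ
      = 0 := by
  set rest : S → {k : ℕ // k ≠ j} → Ω := fun s k => U k s with hrest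
  have mrest : Measurable rest := measurable_pi_lambda _ fun k => hU k
  -- Rebuilds the sequence of conditioning variables from that of unit `j` and the full data of the
  -- other units.
  let glue : β × ({k : ℕ // k ≠ j} → Ω) → ℕ → β :=
    fun p k => if h : k = j then p.1 else X (p.2 ⟨k, h⟩)
  have mglue : Measurable glue := by
    refine measurable_pi_lambda _ fun k => ?_
    by_cases h : k = j
    · simpa only [glue, h, dite_true] using measurable_fst
    · simp only [glue, h, dite_false]
      exact hX.comp ((measurable_pi_apply _).comp measurable_snd)
  have mε := measurable_condResidual hX κ hA
  let F : Ω × ({k : ℕ // k ≠ j} → Ω) → ℝ := fun p =>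
    (H (glue (X p.1, p.2)) * condResidual X κ A (p.2 ⟨l, hjl.symm⟩)) * condResidual X κ A p.1
  have mF : Measurable F := by
    refine (((hH.comp mglue).comp ((hX.comp measurable_fst).prodMk measurable_snd)).mul
      (mε.comp ((measurable_pi_apply _).comp measurable_snd))).mul (mε.comp measurable_fst)
  have key : ∀ s, H (fun k => X (U k s)) * condResidual X κ A (U j s) *
      condResidual X κ A (U l s) = F (U j s, rest s) := fun s => by
    have : glue (X (U j s), rest s) = fun k => X (U k s) := by
      funext k
      by_cases h : k = j
      · subst h; simp [glue]
      · simp [glue, h, hrest]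
    simp only [F, this]
    exact mul_right_comm _ _ _
  have bF : ∀ p, ‖F p‖ ≤ b := fun p => by
    have h1 := abs_condResidual_le X κ A p.1
    have h2 := abs_condResidual_le X κ A (p.2 ⟨l, hjl.symm⟩)
    rw [Real.norm_eq_abs, abs_mul, abs_mul]
    calc _ ≤ |H (glue (X p.1, p.2))| * 1 * 1 := by gcongr
      _ ≤ b := by simpa using hb _
  have : IsProbabilityMeasure (μ.map rest) :=
    Measure.isProbabilityMeasure_map mrest.aemeasurable
  have hprod : μ.map (fun s => (U j s, rest s)) = P.prod (μ.map rest) := by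
    rw [(indepFun_coordinate_rest hU hind j).map_prod_eq_prod_map_map (hU j).aemeasurable
      mrest.aemeasurable, hlaw j]
  simp only [key]
  rw [← integral_map (φ := fun s => (U j s, rest s)) ((hU j).prodMk mrest).aemeasurable
    mF.aestronglyMeasurable, hprod, integral_prod_symm _
    (Integrable.of_bound mF.aestronglyMeasurable b (ae_of_all _ bF))]
  refine integral_eq_zero_of_ae (ae_of_all _ fun y => ?_)
  refine integral_mul_condResidual hX hκ hA
    (φ := fun x => H (glue (x, y)) * condResidual X κ A (y ⟨l, hjl.symm⟩)) ?_ (b := b) ?_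
  · exact ((hH.comp mglue).comp (measurable_id.prodMk measurable_const)).mul measurable_const
  · intro x
    have h2 := abs_condResidual_le X κ A (y ⟨l, hjl.symm⟩)
    rw [abs_mul]
    calc _ ≤ |H (glue (x, y))| * 1 := by gcongr
      _ ≤ b := by simpa using hb _

/-- Weighted sums of conditional residuals have second moment at most the bound on the sum of the
squared weights, provided that the weights are functions of the conditioning variables. -/
lemma integral_sq_sum_condResidual_le {P : Measure Ω} [IsProbabilityMeasure P]
    {X : Ω → β} (hX : Measurable X) {κ : Kernel β Ω} [IsMarkovKernel κ]
    (hκ : IsRegularCondProb P X κ) {A : Set Ω} (hA : MeasurableSet A)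
    {μ : Measure S} [IsProbabilityMeasure μ] {U : ℕ → S → Ω} (hU : ∀ j, Measurable (U j))
    (hlaw : ∀ j, μ.map (U j) = P) (hind : iIndepFun U μ)
    {H : ℕ → (ℕ → β) → ℝ} (hH : ∀ j, Measurable (H j)) {b : ℝ} (hb : ∀ j z, |H j z| ≤ b)
    {N : ℕ} {v : ℝ} (hv : ∀ z, ∑ j ∈ Finset.range N, H j z ^ 2 ≤ v) :
    Integrable (fun s => (∑ j ∈ Finset.range N,
        H j (fun k => X (U k s)) * condResidual X κ A (U j s)) ^ 2) μ ∧
      ∫ s, (∑ j ∈ Finset.range N,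
        H j (fun k => X (U k s)) * condResidual X κ A (U j s)) ^ 2 ∂μ ≤ v := by
  have mε := measurable_condResidual hX κ hA
  have mZ : Measurable fun s => fun k => X (U k s) :=
    measurable_pi_lambda _ fun k => hX.comp (hU k)
  let G : ℕ → ℕ → S → ℝ := fun j l s =>
    (H j (fun k => X (U k s)) * H l (fun k => X (U k s))) * condResidual X κ A (U j s) *
      condResidual X κ A (U l s)
  have mG : ∀ j l, Measurable (G j l) := fun j l =>
    ((((hH j).comp mZ).mul ((hH l).comp mZ)).mul (mε.comp (hU j))).mul (mε.comp (hU l))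
  have bHH : ∀ j l z, |H j z * H l z| ≤ b * b := fun j l z => by
    rw [abs_mul]
    exact mul_le_mul (hb j z) (hb l z) (abs_nonneg _) ((abs_nonneg _).trans (hb j z))
  have iG : ∀ j l, Integrable (G j l) μ := fun j l => by
    refine Integrable.of_bound (mG j l).aestronglyMeasurable (b * b) (ae_of_all _ fun s => ?_)
    have h1 := abs_condResidual_le X κ A (U j s)
    have h2 := abs_condResidual_le X κ A (U l s)
    rw [Real.norm_eq_abs, abs_mul, abs_mul]
    calc _ ≤ |H j (fun k => X (U k s)) * H l (fun k => X (U k s))| * 1 * 1 := by gcongr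
      _ ≤ b * b := by simpa using bHH j l _
  have expand : ∀ s, (∑ j ∈ Finset.range N,
      H j (fun k => X (U k s)) * condResidual X κ A (U j s)) ^ 2
      = ∑ j ∈ Finset.range N, ∑ l ∈ Finset.range N, G j l s := fun s => by
    rw [sq, Finset.sum_mul_sum]
    refine Finset.sum_congr rfl fun j _ => Finset.sum_congr rfl fun l _ => ?_
    simp only [G]
    ring
  have zero : ∀ j l, j ≠ l → ∫ s, G j l s ∂μ = 0 := fun j l hjl =>
    integral_mul_condResidual_mul_condResidual hX hκ hA hU hlaw hind
      (H := fun z => H j z * H l z) ((hH j).mul (hH l)) (bHH j l) hjl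
  simp only [expand]
  refine ⟨integrable_finsetSum _ fun j _ => integrable_finsetSum _ fun l _ => iG j l, ?_⟩
  rw [integral_finsetSum _ fun j _ => integrable_finsetSum _ fun l _ => iG j l]
  -- The off-diagonal terms vanish, so only the squares contribute.
  have diag : ∀ j ∈ Finset.range N,
      ∫ s, ∑ l ∈ Finset.range N, G j l s ∂μ = ∫ s, G j j s ∂μ := fun j hj => by
    rw [integral_finsetSum _ fun l _ => iG j l,
      Finset.sum_eq_single_of_mem j hj fun l _ hl => zero j l hl.symm]
  rw [Finset.sum_congr rfl diag, ← integral_finsetSum _ fun j _ => iG j j]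
  refine (integral_mono_of_nonneg (g := fun _ => v) (ae_of_all _ fun s => ?_)
    (integrable_const _) (ae_of_all _ fun s => ?_)).trans (by simp)
  · refine Finset.sum_nonneg fun j _ => ?_
    have : G j j s = (H j (fun k => X (U k s)) * condResidual X κ A (U j s)) ^ 2 := by
      simp only [G]; ring
    rw [this]
    positivity
  · refine (Finset.sum_le_sum fun j _ => ?_).trans (hv fun k => X (U k s))
    have h1 : condResidual X κ A (U j s) ^ 2 ≤ 1 := by
      rw [← sq_abs]; exact pow_le_one₀ (abs_nonneg _) (abs_condResidual_le _ _ _ _)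
    calc G j j s = H j (fun k => X (U k s)) ^ 2 * condResidual X κ A (U j s) ^ 2 := by
          simp only [G]; ring
      _ ≤ H j (fun k => X (U k s)) ^ 2 * 1 := by gcongr
      _ = _ := mul_one _

/-- Chebyshev's inequality for the second-moment bound. -/
lemma measure_le_abs_sum_condResidual {P : Measure Ω} [IsProbabilityMeasure P]
    {X : Ω → β} (hX : Measurable X) {κ : Kernel β Ω} [IsMarkovKernel κ]
    (hκ : IsRegularCondProb P X κ) {A : Set Ω} (hA : MeasurableSet A)
    {μ : Measure S} [IsProbabilityMeasure μ] {U : ℕ → S → Ω} (hU : ∀ j, Measurable (U j))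
    (hlaw : ∀ j, μ.map (U j) = P) (hind : iIndepFun U μ)
    {H : ℕ → (ℕ → β) → ℝ} (hH : ∀ j, Measurable (H j)) {b : ℝ} (hb : ∀ j z, |H j z| ≤ b)
    {N : ℕ} {v : ℝ} (hv : ∀ z, ∑ j ∈ Finset.range N, H j z ^ 2 ≤ v) {ε : ℝ} (hε : 0 < ε) :
    μ {s | ε ≤ |∑ j ∈ Finset.range N,
      H j (fun k => X (U k s)) * condResidual X κ A (U j s)|} ≤ ENNReal.ofReal (v / ε ^ 2) := by
  obtain ⟨hi, hle⟩ := integral_sq_sum_condResidual_le hX hκ hA hU hlaw hind hH hb hv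
  have h := mul_meas_ge_le_integral_of_nonneg (ae_of_all _ fun s => sq_nonneg _) hi (ε ^ 2)
  have hset : {s | ε ≤ |∑ j ∈ Finset.range N,
      H j (fun k => X (U k s)) * condResidual X κ A (U j s)|} = {s | ε ^ 2 ≤
      (∑ j ∈ Finset.range N, H j (fun k => X (U k s)) * condResidual X κ A (U j s)) ^ 2} := by
    ext s
    simp only [mem_ofPred_eq]
    rw [← sq_abs (∑ j ∈ Finset.range N, _), sq_le_sq₀ hε.le (abs_nonneg _)]
  rw [hset, ← ofReal_measureReal]
  refine ENNReal.ofReal_le_ofReal ?_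
  rw [le_div_iff₀ (by positivity), mul_comm]
  exact h.trans hle

end Independence

/-! ### Minimizers of a weighted check loss are weighted quantiles -/

section CheckLoss

lemma checkLoss_of_nonpos {τ u : ℝ} (hu : u ≤ 0) : checkLoss τ u = (τ - 1) * u := by
  rcases hu.lt_or_eq with h | rfl
  · simp only [checkLoss, h, if_true]; ring
  · simp [checkLoss]

lemma checkLoss_of_nonneg {τ u : ℝ} (hu : 0 ≤ u) : checkLoss τ u = τ * u := by
  simp only [checkLoss, not_lt.2 hu, if_false]; ring

/-- The check loss has slopes `τ - 1` and `τ`, the latter being the larger. -/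
lemma checkLoss_add_sub_le {τ u t : ℝ} (ht : 0 ≤ t) :
    checkLoss τ (u + t) - checkLoss τ u ≤ τ * t := by
  rcases le_total 0 u with h | h
  · rw [checkLoss_of_nonneg h, checkLoss_of_nonneg (add_nonneg h ht)]; linarith
  · rcases le_total 0 (u + t) with h' | h'
    · rw [checkLoss_of_nonpos h, checkLoss_of_nonneg h']; linarith
    · rw [checkLoss_of_nonpos h, checkLoss_of_nonpos h']; linarith

lemma checkLoss_sub_sub_le {τ u t : ℝ} (ht : 0 ≤ t) :
    checkLoss τ (u - t) - checkLoss τ u ≤ (1 - τ) * t := by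
  rcases le_total u 0 with h | h
  · rw [checkLoss_of_nonpos h, checkLoss_of_nonpos (by linarith)]; linarith
  · rcases le_total 0 (u - t) with h' | h'
    · rw [checkLoss_of_nonneg h, checkLoss_of_nonneg h']; linarith
    · rw [checkLoss_of_nonneg h, checkLoss_of_nonpos h']; linarith

variable {ι : Type*} {s : Finset ι} {a y : ι → ℝ} {τ q r : ℝ}

lemma sum_mul_mul_sub (ha1 : ∑ j ∈ s, a j = 1) (t : ℝ) (g : ι → ℝ) :
    ∑ j ∈ s, a j * (t * (τ - g j)) = t * (τ - ∑ j ∈ s, a j * g j) := by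
  have h : ∀ j, a j * (t * (τ - g j)) = t * τ * a j - t * (a j * g j) := fun j => by ring
  simp only [h, Finset.sum_sub_distrib, ← Finset.mul_sum, ha1]
  ring

/-- A minimizer of a weighted check loss does not exceed a point where the weighted distribution
function exceeds `τ`. -/
lemma le_of_lt_sum_indicator (ha : ∀ j ∈ s, 0 ≤ a j) (ha1 : ∑ j ∈ s, a j = 1)
    (hr : ∑ j ∈ s, a j * checkLoss τ (y j - r) ≤ ∑ j ∈ s, a j * checkLoss τ (y j - q))
    (hq : τ < ∑ j ∈ s, a j * (Iic q).indicator 1 (y j)) : r ≤ q := by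
  by_contra! hlt
  -- Moving from `r` down to `q` changes the loss by at most `(r - q) (τ - F(q))`, where `F` is the
  -- weighted distribution function; this is negative, contradicting minimality.
  have hle : ∑ j ∈ s, a j * (checkLoss τ (y j - q) - checkLoss τ (y j - r)) ≤
      ∑ j ∈ s, a j * ((r - q) * (τ - (Iic q).indicator 1 (y j))) := by
    refine Finset.sum_le_sum fun j hj => mul_le_mul_of_nonneg_left ?_ (ha j hj)
    by_cases h : y j ≤ q
    · rw [indicator_of_mem (mem_Iic.2 h), Pi.one_apply, checkLoss_of_nonpos (by linarith),
        checkLoss_of_nonpos (by linarith)]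
      linarith
    · rw [indicator_of_notMem (mt mem_Iic.1 h)]
      have := checkLoss_add_sub_le (τ := τ) (u := y j - r) (sub_nonneg.2 hlt.le)
      rw [show y j - r + (r - q) = y j - q by ring] at this
      linarith
  rw [sum_mul_mul_sub ha1] at hle
  simp only [mul_sub (a _), Finset.sum_sub_distrib] at hle
  nlinarith

/-- A minimizer of a weighted check loss is not below a point where the weighted distribution
function is less than `τ`. -/
lemma le_of_sum_indicator_lt (ha : ∀ j ∈ s, 0 ≤ a j) (ha1 : ∑ j ∈ s, a j = 1)
    (hr : ∑ j ∈ s, a j * checkLoss τ (y j - r) ≤ ∑ j ∈ s, a j * checkLoss τ (y j - q))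
    (hq : ∑ j ∈ s, a j * (Iic q).indicator 1 (y j) < τ) : q ≤ r := by
  by_contra! hlt
  have hle : ∑ j ∈ s, a j * (checkLoss τ (y j - q) - checkLoss τ (y j - r)) ≤
      ∑ j ∈ s, a j * ((r - q) * (τ - (Iic q).indicator 1 (y j))) := by
    refine Finset.sum_le_sum fun j hj => mul_le_mul_of_nonneg_left ?_ (ha j hj)
    by_cases h : y j ≤ q
    · rw [indicator_of_mem (mem_Iic.2 h), Pi.one_apply]
      have := checkLoss_sub_sub_le (τ := τ) (u := y j - r) (sub_nonneg.2 hlt.le)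
      rw [show y j - r - (q - r) = y j - q by ring] at this
      linarith
    · rw [indicator_of_notMem (mt mem_Iic.1 h), checkLoss_of_nonneg (by linarith),
        checkLoss_of_nonneg (by linarith)]
      linarith
  rw [sum_mul_mul_sub ha1] at hle
  simp only [mul_sub (a _), Finset.sum_sub_distrib] at hle
  nlinarith

end CheckLoss

/-! ### Deterministic properties of the matching -/

section Matching

variable {M : UnitModel Ω} {x : ℕ → Ω} {N : ℕ} {δ v : ℝ}

lemma mem_caliperSet {j : ℕ} :
    j ∈ caliperSet M x N δ v ↔ j < N ∧ M.W (x j) ∈ Icc (v - δ) (v + δ) := by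
  simp [caliperSet]

lemma IsMatch.lt {i j : ℕ} (h : IsMatch M x N δ v i j) : j < N := (mem_caliperSet.1 h.1).1

lemma IsMatch.abs_sub_le {i j k : ℕ} (h : IsMatch M x N δ v i j) (hk : k ∈ caliperSet M x N δ v) :
    |M.C (x j) - M.C (x i)| ≤ |M.C (x k) - M.C (x i)| :=
  (h.2 k hk).elim le_of_lt fun h => h.1.le

lemma IsMatch.eq {i j k : ℕ} (hj : IsMatch M x N δ v i j) (hk : IsMatch M x N δ v i k) :
    j = k := by
  rcases hj.2 k hk.1 with h | ⟨_, h⟩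
  · exact absurd (hk.abs_sub_le hj.1) (not_le.2 h)
  · rcases hk.2 j hj.1 with h' | ⟨_, h'⟩
    · exact absurd (hj.abs_sub_le hk.1) (not_le.2 h')
    · exact le_antisymm h h'

lemma exists_isMatch (h : (caliperSet M x N δ v).Nonempty) (i : ℕ) :
    ∃ j, IsMatch M x N δ v i j := by
  -- The lexicographic order on (distance, index) encodes the tie-breaking rule.
  obtain ⟨j, hj, hmin⟩ := Finset.exists_min_image _
    (fun j => toLex (|M.C (x j) - M.C (x i)|, j)) h
  refine ⟨j, hj, fun k hk => ?_⟩
  have := hmin k hk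
  rwa [Prod.Lex.toLex_le_toLex] at this

/-- The number of template units with exposure level `v` that are matched to unit `j`. -/
noncomputable def matchCount (M : UnitModel Ω) (x : ℕ → Ω) (N : ℕ) (δ v : ℝ) (j : ℕ) : ℕ :=
  open Classical in ((Finset.range N).filter (fun i => IsMatch M x N δ v i j)).card

lemma matchCount_le (j : ℕ) : matchCount M x N δ v j ≤ N := by
  classical
  exact (Finset.card_filter_le _ _).trans (by simp)

lemma matchCount_of_notMem {j : ℕ} (hj : j ∉ caliperSet M x N δ v) :
    matchCount M x N δ v j = 0 := by
  classical
  exact Finset.card_eq_zero.2 (Finset.filter_eq_empty_iff.2 fun i _ h => hj h.1)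

/-- Double counting: summing over used units with multiplicity is summing over templates, since each
template has exactly one match. -/
lemma sum_matchCount_mul {m : ℕ → ℕ} (hm : ∀ i < N, IsMatch M x N δ v i (m i)) (φ : ℕ → ℝ) :
    ∑ j ∈ Finset.range N, (matchCount M x N δ v j : ℝ) * φ j
      = ∑ i ∈ Finset.range N, φ (m i) := by
  classical
  have h1 : ∀ j, (matchCount M x N δ v j : ℝ) * φ j =
      ∑ i ∈ Finset.range N, if IsMatch M x N δ v i j then φ j else 0 := fun j => by
    rw [← Finset.sum_filter, Finset.sum_const, nsmul_eq_mul]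
    simp only [matchCount]
  simp only [h1]
  rw [Finset.sum_comm]
  refine Finset.sum_congr rfl fun i hi => ?_
  have hmi := hm i (Finset.mem_range.1 hi)
  rw [Finset.sum_eq_single_of_mem (m i) (Finset.mem_range.2 hmi.lt), if_pos hmi]
  exact fun j _ hj => if_neg fun h => hj (h.eq hmi)

/-- All template units are matched, up to covariate distance `h`, and no unit is used for more than
a proportion `h` of them. -/
structure GoodMatching (M : UnitModel Ω) (x : ℕ → Ω) (N : ℕ) (δ v h : ℝ) : Prop where
  exists_match : ∀ i < N, ∃ j, IsMatch M x N δ v i j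
  close : ∀ i < N, ∀ j, IsMatch M x N δ v i j → |M.C (x j) - M.C (x i)| ≤ h
  count_le : ∀ j, (matchCount M x N δ v j : ℝ) ≤ h * N

lemma exists_mem_bin {c₀ d c : ℝ} (hc : c₀ ≤ c) (n : ℕ) (hn : c ≤ c₀ + (n + 1) * d) :
    ∃ k < n + 1, c ∈ Icc (c₀ + k * d) (c₀ + (k + 1) * d) := by
  induction n with
  | zero => exact ⟨0, by simp, by simpa using hc, by simpa using hn⟩
  | succ n ih =>
    rcases le_total c (c₀ + (n + 1) * d) with h | h
    · obtain ⟨k, hk, hck⟩ := ih h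
      exact ⟨k, by omega, hck⟩
    · exact ⟨n + 1, by omega, by push_cast; exact h, hn⟩

/-- If every bin of a partition of the covariate space contains a unit of the caliper set, and no
enlarged bin contains too many units, then the matching is good. -/
lemma goodMatching_of_bins {c₀ d h : ℝ} {n : ℕ} (hdh : d ≤ h) (hh : 0 ≤ h)
    (hC : ∀ i < N, M.C (x i) ∈ Icc c₀ (c₀ + (n + 1) * d))
    (hcover : ∀ k < n + 1, ∃ j ∈ caliperSet M x N δ v,
      M.C (x j) ∈ Icc (c₀ + k * d) (c₀ + (k + 1) * d))
    (hcount : ∀ k < n + 1, ∑ i ∈ Finset.range N,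
      (Icc (c₀ + k * d - d) (c₀ + (k + 1) * d + d)).indicator 1 (M.C (x i)) ≤ h * N) :
    GoodMatching M x N δ v h := by
  classical
  have hclose : ∀ i < N, ∀ j, IsMatch M x N δ v i j → |M.C (x j) - M.C (x i)| ≤ d := by
    intro i hi j hj
    obtain ⟨k, hk, hik⟩ := exists_mem_bin (hC i hi).1 n (hC i hi).2
    obtain ⟨l, hl, hlk⟩ := hcover k hk
    -- Unit `l` shares the bin of `i`, so it is within `d` of `i`, and the match is no farther.
    refine (hj.abs_sub_le hl).trans (abs_le.2 ⟨?_, ?_⟩) <;>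
      linarith [hik.1, hik.2, hlk.1, hlk.2]
  refine ⟨fun i _ => ?_, fun i hi j hj => (hclose i hi j hj).trans hdh, fun j => ?_⟩
  · obtain ⟨j, hj, _⟩ := hcover 0 (by omega)
    exact exists_isMatch ⟨j, hj⟩ i
  · by_cases hj : j ∈ caliperSet M x N δ v
    · have hjN := (mem_caliperSet.1 hj).1
      obtain ⟨k, hk, hjk⟩ := exists_mem_bin (hC j hjN).1 n (hC j hjN).2
      refine le_trans ?_ (hcount k hk)
      rw [matchCount, Finset.card_filter]
      push_cast
      refine Finset.sum_le_sum fun i hi => ?_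
      by_cases hij : IsMatch M x N δ v i j
      · have := abs_le.1 (hclose i (Finset.mem_range.1 hi) j hij)
        rw [if_pos hij, indicator_of_mem]
        · simp
        · exact ⟨by linarith [this.2, hjk.1], by linarith [this.1, hjk.2]⟩
      · rw [if_neg hij]
        exact indicator_nonneg (fun _ _ => zero_le_one) _
    · rw [matchCount_of_notMem hj]
      simp only [Nat.cast_zero]
      positivity

/-- Units that are not at the boundary of the bin of `w` are used only for the level `w`. -/
lemma replacementCount_eq {levels : Finset ℝ} {w : ℝ} (hw : w ∈ levels)
    (hsep : ∀ v ∈ levels, ∀ v' ∈ levels, v ≠ v' → 2 * δ ≤ |v - v'|) {j : ℕ}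
    (hj : j ∈ caliperSet M x N δ w) (h1 : M.W (x j) ≠ w - δ) (h2 : M.W (x j) ≠ w + δ) :
    replacementCount M x N δ levels j = matchCount M x N δ w j := by
  have hin := (mem_caliperSet.1 hj).2
  refine Finset.sum_eq_single_of_mem w hw fun v hv hvw => matchCount_of_notMem fun hjv => ?_
  have hin' := (mem_caliperSet.1 hjv).2
  -- Off the endpoints `W_j` is strictly within `δ` of `w`; being also within `δ` of `v` would force
  -- `|v - w| < 2δ`.
  have l1 := lt_of_le_of_ne hin.1 (Ne.symm h1)
  have l2 := lt_of_le_of_ne hin.2 h2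
  have := hsep v hv w hw hvw
  rcases abs_cases (v - w) with h | h <;> linarith [hin'.1, hin'.2]

end Matching

/-! ### Hitting probabilities and averages of an i.i.d. sample -/

section Sampling

variable {S : Type*} [MeasurableSpace S] {P : Measure Ω} {μ : Measure S} {U : ℕ → S → Ω}

/-- Sets of probability at least of the order of `δ N`, where `N δ N → ∞`, are hit by a sample of
size `N` with probability tending to one. -/
lemma tendsto_measure_forall_notMem [IsProbabilityMeasure P] (hU : ∀ j, Measurable (U j))
    (hlaw : ∀ j, μ.map (U j) = P) (hind : iIndepFun U μ) {δ : ℕ → ℝ}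
    (hδ : Tendsto (fun N : ℕ => (N : ℝ) * δ N) atTop atTop)
    {B : ℕ → Set Ω} (hB : ∀ N, MeasurableSet (B N)) {c : ℝ} (hc : 0 < c)
    (hcB : ∀ᶠ N in atTop, c * δ N ≤ P.real (B N)) :
    Tendsto (fun N => μ {s | ∀ j < N, U j s ∉ B N}) atTop (𝓝 0) := by
  have hlim : Tendsto (fun N : ℕ => ENNReal.ofReal (Real.exp (-(c * (N * δ N))))) atTop (𝓝 0) := by
    rw [← ENNReal.ofReal_zero]
    exact ENNReal.tendsto_ofReal (Real.tendsto_exp_neg_atTop_nhds_zero.comp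
      (hδ.const_mul_atTop hc))
  refine tendsto_of_tendsto_of_tendsto_of_le_of_le' tendsto_const_nhds hlim
    (Eventually.of_forall fun _ => zero_le) ?_
  filter_upwards [hcB] with N hN
  have hset : {s | ∀ j < N, U j s ∉ B N} = ⋂ j ∈ Finset.range N, U j ⁻¹' (B N)ᶜ := by
    ext s; simp
  have hprob : ∀ j, μ (U j ⁻¹' (B N)ᶜ) = ENNReal.ofReal (1 - P.real (B N)) := fun j => by
    rw [← Measure.map_apply (hU j) (hB N).compl, hlaw j, ← probReal_compl_eq_one_sub (hB N),
      ofReal_measureReal]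
  rw [hset, hind.measure_inter_preimage_eq_mul _ fun j _ => (hB N).compl,
    Finset.prod_congr rfl fun j _ => hprob j, Finset.prod_const, Finset.card_range,
    ← ENNReal.ofReal_pow (sub_nonneg.2 measureReal_le_one)]
  refine ENNReal.ofReal_le_ofReal ?_
  -- The bound `1 - x ≤ exp (-x)` turns the probability of missing `N` times into `exp (-c N δ_N)`.
  calc (1 - P.real (B N)) ^ N ≤ Real.exp (-(c * δ N)) ^ N := by
        refine pow_le_pow_left₀ (sub_nonneg.2 measureReal_le_one) ?_ N
        have := Real.add_one_le_exp (-(c * δ N))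
        linarith
    _ = _ := by rw [← Real.exp_nat_mul]; congr 1; ring

lemma tendstoInMeasure_average [IsProbabilityMeasure μ] (hU : ∀ j, Measurable (U j))
    (hlaw : ∀ j, μ.map (U j) = P) (hind : iIndepFun U μ)
    {g : Ω → ℝ} (hg : Measurable g) {b : ℝ} (hb : ∀ ω, |g ω| ≤ b) :
    TendstoInMeasure μ (fun (N : ℕ) s => (∑ i ∈ Finset.range N, g (U i s)) / N) atTop
      (fun _ => ∫ ω, g ω ∂P) := by
  have hint : ∫ s, g (U 0 s) ∂μ = ∫ ω, g ω ∂P := by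
    rw [← hlaw 0, integral_map (hU 0).aemeasurable hg.aestronglyMeasurable]
  have h := strong_law_ae_real (μ := μ) (fun i s => g (U i s))
    (Integrable.of_bound (hg.comp (hU 0)).aestronglyMeasurable b (ae_of_all _ fun s => hb _))
    (fun i j hij => (hind.indepFun hij).comp hg hg)
    (fun i => IdentDistrib.comp (u := g) ⟨(hU i).aemeasurable, (hU 0).aemeasurable,
      (hlaw i).trans (hlaw 0).symm⟩ hg)
  rw [hint] at h
  refine tendstoInMeasure_of_tendsto_ae (fun N => ?_) h
  exact ((Finset.measurable_sum _ fun i _ => hg.comp (hU i)).div_const _).aestronglyMeasurable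

end Sampling

/-! ### Consequences of the population assumptions -/

section Population

variable {P : Measure Ω} {M : UnitModel Ω} {𝕎 : Set ℝ} {e : ℝ → ℝ → ℝ}

/-- The level `w` may be an endpoint of `𝕎`, but the interval extends to at least one side of `w`,
and half of a small window has length `δ`. -/
lemma exists_le_volume_inter_Icc (h𝕎 : 𝕎.OrdConnected) (h𝕎' : 𝕎.Nontrivial) {w : ℝ} (hw : w ∈ 𝕎) :
    ∃ δ₀ > 0, ∀ δ, 0 ≤ δ → δ ≤ δ₀ →
      ENNReal.ofReal δ ≤ volume (𝕎 ∩ Icc (w - δ) (w + δ)) := by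
  obtain ⟨w', hw', hne⟩ := h𝕎'.exists_ne w
  refine ⟨|w' - w|, abs_pos.2 (sub_ne_zero.2 hne), fun δ h0 hδ => ?_⟩
  rcases hne.lt_or_gt with h | h
  · rw [abs_of_neg (sub_neg.2 h)] at hδ
    refine le_trans (by rw [Real.volume_Icc]; ring_nf; rfl)
      (measure_mono (show Icc (w - δ) w ⊆ _ from fun t ht => ⟨h𝕎.out hw' hw ⟨?_, ht.2⟩, ?_, ?_⟩))
    all_goals linarith [ht.1, ht.2]
  · rw [abs_of_pos (sub_pos.2 h)] at hδ
    refine le_trans (by rw [Real.volume_Icc]; ring_nf; rfl)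
      (measure_mono (show Icc w (w + δ) ⊆ _ from fun t ht => ⟨h𝕎.out hw hw' ⟨ht.1, ?_⟩, ?_, ?_⟩))
    all_goals linarith [ht.1, ht.2]

lemma IsGPS.ae_mem [IsProbabilityMeasure P] (he : IsGPS P M 𝕎 e) (h𝕎 : MeasurableSet 𝕎) :
    ∀ᵐ ω ∂P, M.W ω ∈ 𝕎 := by
  have mX := M.measurable_W.prodMk M.measurable_C
  have := Measure.isProbabilityMeasure_map (μ := P) M.measurable_C.aemeasurable
  have h : ∀ᵐ p ∂((volume.restrict 𝕎).prod (P.map M.C)), p.1 ∈ 𝕎 :=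
    Measure.quasiMeasurePreserving_fst.ae (ae_restrict_mem h𝕎)
  have h2 : ∀ᵐ p ∂(P.map fun ω => (M.W ω, M.C ω)), p.1 ∈ 𝕎 := by
    rw [he.2]; exact (withDensity_absolutelyContinuous _ _).ae_le h
  exact ae_of_ae_map mX.aemeasurable h2

lemma IsGPS.ae_ne [IsProbabilityMeasure P] (he : IsGPS P M 𝕎 e) (t : ℝ) : ∀ᵐ ω ∂P, M.W ω ≠ t := by
  have mX := M.measurable_W.prodMk M.measurable_C
  have := Measure.isProbabilityMeasure_map (μ := P) M.measurable_C.aemeasurable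
  have h : ∀ᵐ p ∂((volume.restrict 𝕎).prod (P.map M.C)), p.1 ≠ t :=
    Measure.quasiMeasurePreserving_fst.ae (ae_restrict_of_ae (Measure.ae_ne volume t))
  have h2 : ∀ᵐ p ∂(P.map fun ω => (M.W ω, M.C ω)), p.1 ≠ t := by
    rw [he.2]; exact (withDensity_absolutelyContinuous _ _).ae_le h
  exact ae_of_ae_map mX.aemeasurable h2

lemma IsGPS.le_measure [IsProbabilityMeasure P] (he : IsGPS P M 𝕎 e) {𝒞 : Set ℝ} {p : ℝ}
    (hp : ∀ w ∈ 𝕎, ∀ c ∈ 𝒞, p ≤ e w c) (h𝕎 : MeasurableSet 𝕎) {A B : Set ℝ}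
    (hA : MeasurableSet A) (hB : MeasurableSet B) (hB𝒞 : B ⊆ 𝒞) :
    ENNReal.ofReal p * (volume (𝕎 ∩ A) * P.map M.C B) ≤ P {ω | M.W ω ∈ A ∧ M.C ω ∈ B} := by
  have mX := M.measurable_W.prodMk M.measurable_C
  have := Measure.isProbabilityMeasure_map (μ := P) M.measurable_C.aemeasurable
  have hQ : MeasurableSet ((𝕎 ∩ A) ×ˢ B) := (h𝕎.inter hA).prod hB
  calc ENNReal.ofReal p * (volume (𝕎 ∩ A) * P.map M.C B)
      = ∫⁻ _ in (𝕎 ∩ A) ×ˢ B, ENNReal.ofReal p ∂((volume.restrict 𝕎).prod (P.map M.C)) := by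
        rw [setLIntegral_const, Measure.prod_prod, Measure.restrict_apply (h𝕎.inter hA)]
        congr 3
        ext t
        simp only [mem_inter_iff]
        tauto
    _ ≤ ∫⁻ x in (𝕎 ∩ A) ×ˢ B, ENNReal.ofReal (e x.1 x.2)
          ∂((volume.restrict 𝕎).prod (P.map M.C)) :=
        setLIntegral_mono' hQ fun x hx =>
          ENNReal.ofReal_le_ofReal (hp _ hx.1.1 _ (hB𝒞 hx.2))
    _ = P ((fun ω => (M.W ω, M.C ω)) ⁻¹' ((𝕎 ∩ A) ×ˢ B)) := by
        rw [← Measure.map_apply mX hQ, he.2, withDensity_apply _ hQ]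
    _ ≤ _ := measure_mono fun ω hω => And.intro hω.1.2 hω.2

section CovariateDensity

variable {c₀ c₁ : ℝ} {f : ℝ → ℝ} {m B : ℝ}

lemma ae_mem_of_map_eq_withDensity
    (hf : P.map M.C = (volume.restrict (Icc c₀ c₁)).withDensity fun c => ENNReal.ofReal (f c)) :
    ∀ᵐ ω ∂P, M.C ω ∈ Icc c₀ c₁ := by
  have h : ∀ᵐ c ∂(P.map M.C), c ∈ Icc c₀ c₁ := by
    rw [hf]
    exact (withDensity_absolutelyContinuous _ _).ae_le (ae_restrict_mem measurableSet_Icc)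
  exact ae_of_ae_map M.measurable_C.aemeasurable h

lemma le_map_Icc
    (hf : P.map M.C = (volume.restrict (Icc c₀ c₁)).withDensity fun c => ENNReal.ofReal (f c))
    (hm : ∀ c ∈ Icc c₀ c₁, m ≤ f c) {l r : ℝ} (hl : c₀ ≤ l) (hr : r ≤ c₁) :
    ENNReal.ofReal m * ENNReal.ofReal (r - l) ≤ P.map M.C (Icc l r) := by
  have hsub : Icc l r ⊆ Icc c₀ c₁ := Icc_subset_Icc hl hr
  rw [hf, withDensity_apply _ measurableSet_Icc, Measure.restrict_restrict measurableSet_Icc,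
    inter_eq_left.2 hsub, ← Real.volume_Icc, ← setLIntegral_const]
  exact setLIntegral_mono' measurableSet_Icc fun c hc => ENNReal.ofReal_le_ofReal (hm c (hsub hc))

lemma map_Icc_le
    (hf : P.map M.C = (volume.restrict (Icc c₀ c₁)).withDensity fun c => ENNReal.ofReal (f c))
    (hB : ∀ c ∈ Icc c₀ c₁, f c ≤ B) (l r : ℝ) :
    P.map M.C (Icc l r) ≤ ENNReal.ofReal B * ENNReal.ofReal (r - l) := by
  rw [hf, withDensity_apply _ measurableSet_Icc, Measure.restrict_restrict measurableSet_Icc]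
  calc _ ≤ ∫⁻ _ in Icc l r ∩ Icc c₀ c₁, ENNReal.ofReal B :=
        setLIntegral_mono' (measurableSet_Icc.inter measurableSet_Icc) fun c hc =>
          ENNReal.ofReal_le_ofReal (hB c hc.2)
    _ ≤ _ := by
        rw [setLIntegral_const, ← Real.volume_Icc]
        gcongr
        exact inter_subset_left

end CovariateDensity

/-- For almost every value of `(W, C)` the conditional law is carried by the fibre over that value.
On this fibre the exposure is constant, so consistency replaces the observed outcome by one fixed
potential outcome. -/
lemma ae_kernel_real_eq_condCDFAt [IsProbabilityMeasure P] {κ : Kernel (ℝ × ℝ) Ω} [IsMarkovKernel κ]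
    (hκ : IsRegularCondProb P (fun ω => (M.W ω, M.C ω)) κ) (hcons : Consistency M 𝕎) (q : ℝ) :
    ∀ᵐ ω ∂P, M.W ω ∈ 𝕎 →
      (κ (M.W ω, M.C ω)).real {ω' | M.Yobs ω' ≤ q} = condCDFAt M κ q (M.W ω) (M.C ω) := by
  have mX := M.measurable_W.prodMk M.measurable_C
  have := Measure.isProbabilityMeasure_map (μ := P) mX.aemeasurable
  have hset : MeasurableSet {y : (ℝ × ℝ) × Ω | y.1 = (M.W y.2, M.C y.2)} :=
    measurableSet_eq_fun measurable_fst (mX.comp measurable_snd)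
  have h1 : ∀ᵐ y ∂(P.map fun ω => ((M.W ω, M.C ω), ω)), y.1 = (M.W y.2, M.C y.2) := by
    rw [ae_map_iff (mX.prodMk measurable_id').aemeasurable hset]
    exact ae_of_all _ fun _ => rfl
  rw [← hκ] at h1
  have h2 := ae_of_ae_map mX.aemeasurable (Measure.ae_ae_of_ae_compProd h1)
  filter_upwards [h2] with ω hω hmem
  refine measureReal_congr ?_
  filter_upwards [hω] with ω' hω'
  have hW : M.W ω' = M.W ω := (congrArg Prod.fst hω').symm
  exact congrArg (· ≤ q) (hcons _ hmem ω' hW)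

lemma integral_kernel_real_eq_potCDF [IsProbabilityMeasure P] {η : Kernel ℝ Ω} [IsMarkovKernel η]
    (hη : IsRegularCondProb P M.C η) (w q : ℝ) :
    ∫ ω, (η (M.C ω)).real {ω' | M.Y w ω' ≤ q} ∂P = potCDF P M w q := by
  have mY : Measurable (M.Y w) := M.measurable_Y.comp measurable_prodMk_left
  have hA : MeasurableSet {ω' | M.Y w ω' ≤ q} := measurableSet_le mY measurable_const
  have h := integral_indicator_eq_integral_kernel M.measurable_C hη hA
    (φ := fun _ => 1) measurable_const (b := 1) (by simp)
  simp only [one_mul] at h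
  rw [← h, integral_indicator_one hA, potCDF]

lemma potCDF_eq_cdf [IsProbabilityMeasure P] (w q : ℝ) :
    potCDF P M w q = cdf (P.map (M.Y w)) q := by
  have mY : Measurable (M.Y w) := M.measurable_Y.comp measurable_prodMk_left
  have := Measure.isProbabilityMeasure_map (μ := P) mY.aemeasurable
  rw [cdf_eq_real, map_measureReal_apply mY measurableSet_Iic]
  rfl

/-- The limit `0` of the distribution function at `-∞` makes the set in the infimum bounded below,
so that `sInf` is a genuine infimum. -/
lemma potCDF_lt_of_lt_qerf [IsProbabilityMeasure P] {τ w q : ℝ} (hτ : 0 < τ)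
    (hq : q < qerf P M τ w) :
    potCDF P M w q < τ := by
  have h := tendsto_cdf_atBot (P.map (M.Y w))
  obtain ⟨r, hr⟩ := (h.eventually (gt_mem_nhds hτ)).exists
  have hbdd : BddBelow {q : ℝ | τ ≤ potCDF P M w q} := ⟨r, fun t ht => by
    by_contra! hlt
    have := monotone_cdf (P.map (M.Y w)) hlt.le
    rw [mem_ofPred_eq, potCDF_eq_cdf] at ht
    linarith⟩
  exact not_le.1 (notMem_of_lt_csInf (s := {q : ℝ | τ ≤ potCDF P M w q}) hq hbdd)

/-- Here the limit `1` at `+∞` makes the set nonempty. The inequality is weak because the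
distribution function may be flat beyond the quantile. -/
lemma le_potCDF_of_qerf_lt [IsProbabilityMeasure P] {τ w q : ℝ} (hτ : τ < 1)
    (hq : qerf P M τ w < q) :
    τ ≤ potCDF P M w q := by
  have h := tendsto_cdf_atTop (P.map (M.Y w))
  obtain ⟨r, hr⟩ := (h.eventually (lt_mem_nhds hτ)).exists
  have hne : {q : ℝ | τ ≤ potCDF P M w q}.Nonempty := ⟨r, by
    rw [mem_ofPred_eq, potCDF_eq_cdf]; exact hr.le⟩
  obtain ⟨t, ht, htq⟩ := exists_lt_of_csInf_lt hne hq
  rw [mem_ofPred_eq, potCDF_eq_cdf] at ht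
  rw [potCDF_eq_cdf]
  exact ht.trans (monotone_cdf _ htq.le)

end Population

/-! ### Measurability of the match counts -/

section Measurability

lemma measurableSet_isMatch (M : UnitModel Ω) (N : ℕ) (δ v : ℝ) (i j : ℕ) :
    MeasurableSet {x : ℕ → Ω | IsMatch M x N δ v i j} := by
  have mW : ∀ k, Measurable fun x : ℕ → Ω => M.W (x k) := fun k =>
    M.measurable_W.comp (measurable_pi_apply k)
  have mD : ∀ k, Measurable fun x : ℕ → Ω => |M.C (x k) - M.C (x i)| := fun k =>
    ((M.measurable_C.comp (measurable_pi_apply k)).sub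
      (M.measurable_C.comp (measurable_pi_apply i))).abs
  have mcal : ∀ k, MeasurableSet {x : ℕ → Ω | k ∈ caliperSet M x N δ v} := fun k => by
    simp only [mem_caliperSet]
    exact (MeasurableSet.const _).inter (mW k measurableSet_Icc)
  simp only [IsMatch]
  have hset : {x : ℕ → Ω | ∀ k ∈ caliperSet M x N δ v,
      |M.C (x j) - M.C (x i)| < |M.C (x k) - M.C (x i)| ∨
        (|M.C (x j) - M.C (x i)| = |M.C (x k) - M.C (x i)| ∧ j ≤ k)} =
      ⋂ k, {x | k ∈ caliperSet M x N δ v}ᶜ ∪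
        ({x | |M.C (x j) - M.C (x i)| < |M.C (x k) - M.C (x i)|} ∪
        ({x | |M.C (x j) - M.C (x i)| = |M.C (x k) - M.C (x i)|} ∩ {_x | j ≤ k})) := by
    ext x
    simp only [mem_iInter, mem_union, mem_compl_iff, mem_inter_iff, mem_ofPred_eq, imp_iff_not_or]
  refine (mcal j).inter (MeasurableSet.congr ?_ hset.symm)
  exact MeasurableSet.iInter fun k => (mcal k).compl.union ((measurableSet_lt (mD j) (mD k)).union
    ((measurableSet_eq_fun (mD j) (mD k)).inter (MeasurableSet.const _)))

lemma measurable_matchCount (M : UnitModel Ω) (N : ℕ) (δ v : ℝ) (j : ℕ) :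
    Measurable fun x : ℕ → Ω => (matchCount M x N δ v j : ℝ) := by
  classical
  simp only [matchCount, Finset.card_filter]
  push_cast
  refine Finset.measurable_sum _ fun i _ => ?_
  exact Measurable.ite (measurableSet_isMatch M N δ v i j) measurable_const measurable_const

lemma sum_matchCount_le (M : UnitModel Ω) (x : ℕ → Ω) (N : ℕ) (δ v : ℝ) :
    ∑ j ∈ Finset.range N, (matchCount M x N δ v j : ℝ) ≤ N := by
  rcases (caliperSet M x N δ v).eq_empty_or_nonempty with h | h
  · rw [Finset.sum_eq_zero fun j _ => by rw [matchCount_of_notMem (by simp [h]), Nat.cast_zero]]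
    positivity
  · choose m hm using exists_isMatch h
    simpa using (sum_matchCount_mul (fun i _ => hm i) fun _ => 1).le

/-- The exposure and the covariate as a unit model of their own. -/
noncomputable def exposureCovariateModel : UnitModel (ℝ × ℝ) where
  W := Prod.fst
  C := Prod.snd
  Y := fun _ _ => 0
  Yobs := fun _ => 0
  measurable_W := measurable_fst
  measurable_C := measurable_snd
  measurable_Y := measurable_const
  measurable_Yobs := measurable_const

end Measurability

/-! ### The matching is good with probability tending to one -/

section Convergence

variable {S : Type*} [MeasurableSpace S] {P : Measure Ω} {M : UnitModel Ω} {𝕎 : Set ℝ}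
  {e : ℝ → ℝ → ℝ} {μ : Measure S} {U : ℕ → S → Ω}

lemma tendsto_measure_zero_of_subset {A B : ℕ → Set S}
    (hA : Tendsto (fun N => μ (A N)) atTop (𝓝 0)) (h : ∀ᶠ N in atTop, B N ⊆ A N) :
    Tendsto (fun N => μ (B N)) atTop (𝓝 0) :=
  tendsto_of_tendsto_of_tendsto_of_le_of_le' tendsto_const_nhds hA
    (Eventually.of_forall fun _ => zero_le) (h.mono fun _ h => measure_mono h)

lemma tendsto_measure_union_zero {A B : ℕ → Set S}
    (hA : Tendsto (fun N => μ (A N)) atTop (𝓝 0)) (hB : Tendsto (fun N => μ (B N)) atTop (𝓝 0)) :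
    Tendsto (fun N => μ (A N ∪ B N)) atTop (𝓝 0) :=
  tendsto_of_tendsto_of_tendsto_of_le_of_le tendsto_const_nhds (by simpa using hA.add hB)
    (fun _ => zero_le) fun _ => measure_union_le _ _

lemma tendsto_measure_biUnion_zero {ι : Type*} (t : Finset ι) {A : ι → ℕ → Set S}
    (hA : ∀ k ∈ t, Tendsto (fun N => μ (A k N)) atTop (𝓝 0)) :
    Tendsto (fun N => μ (⋃ k ∈ t, A k N)) atTop (𝓝 0) :=
  tendsto_of_tendsto_of_tendsto_of_le_of_le tendsto_const_nhds
    (by simpa using tendsto_finsetSum t hA) (fun _ => zero_le)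
    fun _ => measure_biUnion_finset_le _ _

lemma tendsto_measure_not_of_ae {p : S → Prop} (h : ∀ᵐ s ∂μ, p s) :
    Tendsto (fun _ : ℕ => μ {s | ¬ p s}) atTop (𝓝 0) := by
  rw [ae_iff.1 h]
  exact tendsto_const_nhds

lemma ae_forall_sample (hU : ∀ j, Measurable (U j)) (hlaw : ∀ j, μ.map (U j) = P) {p : Ω → Prop}
    (hp : ∀ᵐ ω ∂P, p ω) : ∀ᵐ s ∂μ, ∀ j, p (U j s) :=
  ae_all_iff.2 fun j => ae_of_ae_map (hU j).aemeasurable (by rwa [hlaw j])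

/-- For fixed `h` the number of bins is fixed, so a union bound over bins suffices: each bin is hit
by the exposure window, and each enlarged bin has a small empirical share by the law of large
numbers. -/
lemma tendsto_measure_not_goodMatching [IsProbabilityMeasure P] [IsProbabilityMeasure μ]
    (hU : ∀ j, Measurable (U j)) (hlaw : ∀ j, μ.map (U j) = P) (hind : iIndepFun U μ)
    (h𝕎 : 𝕎.OrdConnected) (h𝕎' : 𝕎.Nontrivial) {c₀ c₁ : ℝ} (hc : c₀ < c₁) (he : IsGPS P M 𝕎 e)
    (hover : Overlap 𝕎 (Icc c₀ c₁) e) {f : ℝ → ℝ}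
    (hf : P.map M.C = (volume.restrict (Icc c₀ c₁)).withDensity fun c => ENNReal.ofReal (f c))
    {m B : ℝ} (hm : 0 < m) (hmf : ∀ c ∈ Icc c₀ c₁, m ≤ f c) (hfB : ∀ c ∈ Icc c₀ c₁, f c ≤ B)
    {w : ℝ} (hw : w ∈ 𝕎) {δ : ℕ → ℝ} (hδ : Tendsto δ atTop (𝓝 0))
    (hNδ : Tendsto (fun N : ℕ => (N : ℝ) * δ N) atTop atTop) {h : ℝ} (hh : 0 < h) :
    Tendsto (fun N => μ {s | ¬ GoodMatching M (fun j => U j s) N (δ N) w h}) atTop (𝓝 0) := by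
  have hB : 0 < B := hm.trans_le ((hmf c₀ ⟨le_rfl, hc.le⟩).trans (hfB c₀ ⟨le_rfl, hc.le⟩))
  -- An enlarged bin has length `3 * d`, hence probability at most `h / 2`; the other half of `h`
  -- absorbs the sampling error.
  obtain ⟨n, d, hd, hn, hdh, hdB⟩ : ∃ (n : ℕ) (d : ℝ), 0 < d ∧ c₀ + (n + 1) * d = c₁ ∧ d ≤ h ∧
      B * (3 * d) ≤ h / 2 := by
    have hlim : Tendsto (fun n : ℕ => (c₁ - c₀) * (1 / ((n : ℝ) + 1))) atTop (𝓝 0) := by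
      simpa using tendsto_one_div_add_atTop_nhds_zero_nat.const_mul (c₁ - c₀)
    have hpos : 0 < min h (h / (6 * B)) := lt_min hh (by positivity)
    obtain ⟨n, hn⟩ := (hlim.eventually (gt_mem_nhds hpos)).exists
    refine ⟨n, (c₁ - c₀) * (1 / ((n : ℝ) + 1)), mul_pos (sub_pos.2 hc) (by positivity), ?_,
      (hn.le.trans (min_le_left _ _)), ?_⟩
    · field_simp; ring
    · have := (hn.le.trans (min_le_right _ _))
      rw [le_div_iff₀ (by positivity)] at this
      linarith
  obtain ⟨p, hp, hpe⟩ := hover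
  obtain ⟨δ₀, hδ₀, hvol⟩ := exists_le_volume_inter_Icc h𝕎 h𝕎' hw
  have hδpos : ∀ᶠ N in atTop, 0 < δ N := by
    filter_upwards [hNδ.eventually_gt_atTop 0] with N hN
    exact (pos_iff_pos_of_mul_pos hN).1
      (lt_of_le_of_ne (Nat.cast_nonneg N) fun h0 => by simp [← h0] at hN)
  have hmC : ∀ l r : ℝ, MeasurableSet {ω | M.C ω ∈ Icc l r} := fun l r =>
    M.measurable_C measurableSet_Icc
  have hcover : ∀ k ∈ Finset.range (n + 1), Tendsto (fun N => μ {s | ∀ j < N, U j s ∉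
      {ω | M.W ω ∈ Icc (w - δ N) (w + δ N) ∧ M.C ω ∈ Icc (c₀ + k * d) (c₀ + (k + 1) * d)}})
      atTop (𝓝 0) := by
    intro k hk
    have hkn : (k : ℝ) + 1 ≤ n + 1 := by exact_mod_cast Finset.mem_range.1 hk
    have hl : c₀ ≤ c₀ + k * d := le_add_of_nonneg_right (by positivity)
    have hr : c₀ + (k + 1) * d ≤ c₁ := by
      rw [← hn]; gcongr
    -- The constant combines the overlap bound `p` with the mass `m * d` of a bin; the factor `δ N`
    -- is the length of the part of the window inside `𝕎`.
    refine tendsto_measure_forall_notMem hU hlaw hind hNδ (c := p * (m * d))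
      (fun N => (M.measurable_W measurableSet_Icc).inter (hmC _ _)) (by positivity) ?_
    filter_upwards [hδpos, hδ.eventually (gt_mem_nhds hδ₀)] with N h1 h2
    rw [← ENNReal.ofReal_le_ofReal_iff measureReal_nonneg, ofReal_measureReal]
    refine le_trans ?_ (he.le_measure hpe h𝕎.measurableSet measurableSet_Icc measurableSet_Icc
      (Icc_subset_Icc hl hr))
    have e1 : p * (m * d) * δ N = p * (δ N * (m * d)) := by ring
    rw [e1, ENNReal.ofReal_mul hp.le, ENNReal.ofReal_mul h1.le, ENNReal.ofReal_mul hm.le]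
    gcongr
    · exact hvol _ h1.le h2.le
    · refine le_trans ?_ (le_map_Icc hf hmf hl hr)
      rw [show c₀ + (k + 1) * d - (c₀ + k * d) = d by ring]
  have hcount : ∀ k ∈ Finset.range (n + 1), Tendsto (fun N => μ {s | ¬ ∑ i ∈ Finset.range N,
      (Icc (c₀ + k * d - d) (c₀ + (k + 1) * d + d)).indicator 1 (M.C (U i s)) ≤ h * N})
      atTop (𝓝 0) := by
    intro k _
    set I := Icc (c₀ + k * d - d) (c₀ + (k + 1) * d + d)
    have hg : Measurable fun ω => I.indicator (1 : ℝ → ℝ) (M.C ω) :=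
      (measurable_one.indicator measurableSet_Icc).comp M.measurable_C
    have hg1 : ∀ ω, |I.indicator (1 : ℝ → ℝ) (M.C ω)| ≤ 1 := fun ω => by
      by_cases hω : M.C ω ∈ I <;> simp [hω]
    have hmean : ∫ ω, I.indicator (1 : ℝ → ℝ) (M.C ω) ∂P ≤ h / 2 := by
      rw [← integral_map M.measurable_C.aemeasurable
        (measurable_one.indicator measurableSet_Icc).aestronglyMeasurable,
        integral_indicator_one measurableSet_Icc]
      refine ENNReal.toReal_le_of_le_ofReal (by positivity) ((map_Icc_le hf hfB _ _).trans ?_)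
      rw [← ENNReal.ofReal_mul hB.le]
      refine ENNReal.ofReal_le_ofReal (le_trans (le_of_eq ?_) hdB)
      ring
    have hlln := tendstoInMeasure_iff_norm.1 (tendstoInMeasure_average hU hlaw hind hg hg1)
      (h / 2) (by positivity)
    refine tendsto_measure_zero_of_subset hlln ?_
    filter_upwards [eventually_gt_atTop 0] with N hN s hs
    have hN' : (0 : ℝ) < N := by exact_mod_cast hN
    have hs' := not_le.1 hs
    rw [← lt_div_iff₀ hN'] at hs'
    have hdiff : h / 2 ≤ (∑ i ∈ Finset.range N, I.indicator (1 : ℝ → ℝ) (M.C (U i s))) / N -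
        ∫ ω, I.indicator (1 : ℝ → ℝ) (M.C ω) ∂P := by linarith
    exact hdiff.trans (le_abs_self _)
  have hnull := tendsto_measure_not_of_ae
    (ae_forall_sample hU hlaw (ae_mem_of_map_eq_withDensity hf))
  refine tendsto_measure_zero_of_subset (tendsto_measure_union_zero (tendsto_measure_union_zero
    (tendsto_measure_biUnion_zero _ hcover) (tendsto_measure_biUnion_zero _ hcount)) hnull)
    (Eventually.of_forall fun N s hs => ?_)
  by_contra hcon
  simp only [mem_union, mem_iUnion, Finset.mem_range, mem_ofPred_eq, not_or, not_exists,
    not_not, not_forall] at hcon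
  obtain ⟨⟨h1, h2⟩, h3⟩ := hcon
  refine hs (goodMatching_of_bins (c₀ := c₀) (d := d) (n := n) hdh hh.le (fun i _ => ?_) ?_ h2)
  · rw [hn]; exact h3 i
  · intro k hk
    obtain ⟨j, hj, hjW, hjC⟩ := h1 k hk
    exact ⟨j, mem_caliperSet.2 ⟨hj, hjW⟩, hjC⟩

end Convergence

/-! ### Convergence of the matched distribution function -/

section MatchedDistribution

variable {S : Type*} [MeasurableSpace S] {P : Measure Ω} {M : UnitModel Ω} {𝕎 : Set ℝ}
  {e : ℝ → ℝ → ℝ} {μ : Measure S} {U : ℕ → S → Ω}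

/-- The distribution function at `q` of the observed outcomes in the matched sample at level
`w`. -/
noncomputable def matchedCDF (M : UnitModel Ω) (x : ℕ → Ω) (N : ℕ) (δ w q : ℝ) : ℝ :=
  ∑ j ∈ Finset.range N, (matchCount M x N δ w j : ℝ) / N * (Iic q).indicator 1 (M.Yobs (x j))

/-- On a good matching every weight is at most `h` and the weights sum to at most one, so their
squares sum to at most `h`, and Chebyshev applies. -/
lemma measure_le_abs_matched_residual [IsProbabilityMeasure P] [IsProbabilityMeasure μ]
    (hU : ∀ j, Measurable (U j)) (hlaw : ∀ j, μ.map (U j) = P) (hind : iIndepFun U μ)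
    {κ : Kernel (ℝ × ℝ) Ω} [IsMarkovKernel κ]
    (hκ : IsRegularCondProb P (fun ω => (M.W ω, M.C ω)) κ) {A : Set Ω} (hA : MeasurableSet A)
    (N : ℕ) (δ w : ℝ) {h ε : ℝ} (hh : 0 ≤ h) (hε : 0 < ε) :
    μ {s | ε ≤ |∑ j ∈ Finset.range N, (matchCount M (fun j => U j s) N δ w j : ℝ) / N *
        condResidual (fun ω => (M.W ω, M.C ω)) κ A (U j s)|} ≤
      ENNReal.ofReal (h / ε ^ 2) +
        μ {s | ¬ GoodMatching M (fun j => U j s) N δ w h} := by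
  classical
  -- Matching on the bare pairs `(W, C)` gives the same counts, which exhibits the weights as
  -- functions of the conditioning variables.
  let k : ℕ → (ℕ → ℝ × ℝ) → ℝ := fun j z => matchCount exposureCovariateModel z N δ w j
  have mk : ∀ j, Measurable (k j) := measurable_matchCount _ N δ w
  have k0 : ∀ j z, 0 ≤ k j z := fun _ _ => Nat.cast_nonneg _
  -- Truncation has to preserve dependence on `(W, C)` only, so it uses just the bound on the
  -- counts. It makes the bound on the squared weights hold everywhere.
  let G : Set (ℕ → ℝ × ℝ) := {z | ∀ j, k j z ≤ h * N}
  have mG : MeasurableSet G := by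
    have : G = ⋂ j, {z | k j z ≤ h * N} := by ext z; simp [G]
    rw [this]
    exact MeasurableSet.iInter fun j => measurableSet_le (mk j) measurable_const
  let H : ℕ → (ℕ → ℝ × ℝ) → ℝ := fun j => G.indicator fun z => k j z / N
  have bH : ∀ j z, |H j z| ≤ 1 := fun j z => by
    by_cases hz : z ∈ G
    · simp only [H, indicator_of_mem hz]
      rw [abs_of_nonneg (div_nonneg (k0 j z) (Nat.cast_nonneg _))]
      exact div_le_one_of_le₀ (Nat.cast_le.2 (matchCount_le j)) (Nat.cast_nonneg _)
    · simp [H, indicator_of_notMem hz]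
  have sH : ∀ z, ∑ j ∈ Finset.range N, H j z ^ 2 ≤ h := fun z => by
    rcases Nat.eq_zero_or_pos N with rfl | hN
    · simpa using hh
    have hN' : (0 : ℝ) < N := Nat.cast_pos.2 hN
    by_cases hz : z ∈ G
    · simp only [H, indicator_of_mem hz]
      calc ∑ j ∈ Finset.range N, (k j z / N) ^ 2
          ≤ ∑ j ∈ Finset.range N, h / N * k j z := by
            refine Finset.sum_le_sum fun j _ => ?_
            have h1 : k j z / N ≤ h := (div_le_iff₀ hN').2 (hz j)
            calc (k j z / N) ^ 2 = k j z / N * (k j z / N) := sq _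
              _ ≤ h * (k j z / N) := mul_le_mul_of_nonneg_right h1 (div_nonneg (k0 j z) hN'.le)
              _ = _ := by ring
        _ = h / N * ∑ j ∈ Finset.range N, k j z := (Finset.mul_sum _ _ _).symm
        _ ≤ h / N * N := mul_le_mul_of_nonneg_left (sum_matchCount_le _ _ _ _ _) (by positivity)
        _ = h := div_mul_cancel₀ _ hN'.ne'
    · simpa [H, indicator_of_notMem hz] using hh
  have hcheb := measure_le_abs_sum_condResidual (M.measurable_W.prodMk M.measurable_C) hκ hA hU
    hlaw hind (fun j => ((mk j).div_const (N : ℝ)).indicator mG) bH sH hε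
  refine le_trans (measure_mono fun s hs => ?_) ((measure_union_le _ _).trans
    (add_le_add_left hcheb _))
  by_cases hgood : GoodMatching M (fun j => U j s) N δ w h
  · left
    have hz : (fun i => (M.W (U i s), M.C (U i s))) ∈ G := hgood.count_le
    simp only [mem_ofPred_eq, indicator_of_mem hz]
    exact hs
  · exact Or.inr hgood

/-- Fix `h` small enough for the Chebyshev term first, then let `N` grow. -/
lemma tendsto_measure_matched_residual [IsProbabilityMeasure P] [IsProbabilityMeasure μ]
    (hU : ∀ j, Measurable (U j)) (hlaw : ∀ j, μ.map (U j) = P) (hind : iIndepFun U μ)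
    {κ : Kernel (ℝ × ℝ) Ω} [IsMarkovKernel κ]
    (hκ : IsRegularCondProb P (fun ω => (M.W ω, M.C ω)) κ) {A : Set Ω} (hA : MeasurableSet A)
    {δ : ℕ → ℝ} {w : ℝ} (hgood : ∀ h > 0, Tendsto
      (fun N => μ {s | ¬ GoodMatching M (fun j => U j s) N (δ N) w h}) atTop (𝓝 0))
    {ε : ℝ} (hε : 0 < ε) :
    Tendsto (fun N => μ {s | ε ≤ |∑ j ∈ Finset.range N,
      (matchCount M (fun j => U j s) N (δ N) w j : ℝ) / N *
        condResidual (fun ω => (M.W ω, M.C ω)) κ A (U j s)|}) atTop (𝓝 0) := by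
  rw [ENNReal.tendsto_nhds_zero]
  intro t ht
  have hlim : Tendsto (fun h : ℝ => ENNReal.ofReal (h / ε ^ 2)) (𝓝[>] 0) (𝓝 0) := by
    have : Tendsto (fun h : ℝ => h / ε ^ 2) (𝓝[>] 0) (𝓝 0) := by
      have h0 : Tendsto (fun h : ℝ => h / ε ^ 2) (𝓝 0) (𝓝 (0 / ε ^ 2)) :=
        tendsto_id.div_const _
      rw [zero_div] at h0
      exact h0.mono_left nhdsWithin_le_nhds
    simpa using ENNReal.tendsto_ofReal this
  have ht2 : 0 < t / 2 := ENNReal.half_pos ht.ne'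
  obtain ⟨h, hh, hpos⟩ := ((ENNReal.tendsto_nhds_zero.1 hlim _ ht2).and
    self_mem_nhdsWithin).exists
  filter_upwards [ENNReal.tendsto_nhds_zero.1 (hgood h hpos) _ ht2] with N hN
  calc _ ≤ _ := measure_le_abs_matched_residual hU hlaw hind hκ hA N (δ N) w (le_of_lt hpos) hε
    _ ≤ t / 2 + t / 2 := add_le_add hh hN
    _ = t := ENNReal.add_halves t

/-- On a good matching the mean of a function `g` over the matched sample is close to the mean over
the whole sample of a function to which `g` is close at matched pairs. -/
lemma abs_sum_matchCount_sub_le {x : ℕ → Ω} {N : ℕ} (hN : 0 < N) {δ w r : ℝ}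
    (hex : ∀ i < N, ∃ j, IsMatch M x N δ w i j) {g g' : ℕ → ℝ}
    (hg : ∀ i < N, ∀ j, IsMatch M x N δ w i j → |g j - g' i| ≤ r) :
    |∑ j ∈ Finset.range N, (matchCount M x N δ w j : ℝ) / N * g j -
      (∑ i ∈ Finset.range N, g' i) / N| ≤ r := by
  have hN' : (0 : ℝ) < N := Nat.cast_pos.2 hN
  -- Makes the match a function on all of `ℕ`; the value `0` beyond the sample is irrelevant.
  have hex' : ∀ i, ∃ j, i < N → IsMatch M x N δ w i j := fun i => by
    by_cases hi : i < N
    · exact (hex i hi).imp fun _ h _ => h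
    · exact ⟨0, fun h => absurd h hi⟩
  choose m hm using hex'
  have e1 : ∑ j ∈ Finset.range N, (matchCount M x N δ w j : ℝ) / N * g j =
      (∑ i ∈ Finset.range N, g (m i)) / N := by
    rw [← sum_matchCount_mul hm, Finset.sum_div]
    exact Finset.sum_congr rfl fun _ _ => by ring
  rw [e1, ← sub_div, ← Finset.sum_sub_distrib, abs_div, abs_of_pos hN', div_le_iff₀ hN']
  calc _ ≤ ∑ i ∈ Finset.range N, |g (m i) - g' i| := Finset.abs_sum_le_sum_abs _ _
    _ ≤ ∑ i ∈ Finset.range N, r := Finset.sum_le_sum fun i hi =>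
        hg i (Finset.mem_range.1 hi) _ (hm i (Finset.mem_range.1 hi))
    _ = r * N := by simp [mul_comm]

/-- Change the exposure at the covariate `c'`, then the covariate at `w`. Thus `K` must be uniform
in the covariate, while `L` is needed only at the level `w`. -/
lemma abs_condCDFAt_sub_le {κ : Kernel (ℝ × ℝ) Ω} {q : ℝ} {𝒞 : Set ℝ} {K L : NNReal}
    (hK : ∀ c ∈ 𝒞, LipschitzOnWith K (fun w => condCDFAt M κ q w c) 𝕎) {w : ℝ} (hw : w ∈ 𝕎)
    (hL : LipschitzOnWith L (fun c => condCDFAt M κ q w c) 𝒞) {w' c c' : ℝ} (hw' : w' ∈ 𝕎)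
    (hc : c ∈ 𝒞) (hc' : c' ∈ 𝒞) :
    |condCDFAt M κ q w' c' - condCDFAt M κ q w c| ≤ K * |w' - w| + L * |c' - c| := by
  have h1 := (hK c' hc').dist_le_mul w' hw' w hw
  have h2 := hL.dist_le_mul c' hc' c hc
  rw [Real.dist_eq, Real.dist_eq] at h1 h2
  exact (abs_sub_le _ (condCDFAt M κ q w c') _).trans (add_le_add h1 h2)

/-- The window contains its centre, so the two conditional laws can be compared at exposure `w`
itself. -/
lemma LocalWeakUnconfoundedness.condCDFAt_eq {κ : Kernel (ℝ × ℝ) Ω} {η : Kernel ℝ Ω}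
    {𝒞 : Set ℝ} {δ : ℝ} (h : LocalWeakUnconfoundedness M 𝕎 𝒞 κ η δ) (hδ : 0 ≤ δ) {w c : ℝ}
    (hw : w ∈ 𝕎) (hc : c ∈ 𝒞) (q : ℝ) :
    condCDFAt M κ q w c = (η c).real {ω | M.Y w ω ≤ q} := by
  have mY : Measurable (M.Y w) := M.measurable_Y.comp measurable_prodMk_left
  have h1 := h w hw w ⟨hw, by constructor <;> linarith⟩ c hc
  have h2 := congrArg (fun ν : Measure ℝ => ν.real (Iic q)) h1
  simp only [map_measureReal_apply mY measurableSet_Iic] at h2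
  exact h2

lemma tendstoInMeasure_matchedCDF [IsProbabilityMeasure P] [IsProbabilityMeasure μ]
    (hU : ∀ j, Measurable (U j)) (hlaw : ∀ j, μ.map (U j) = P) (hind : iIndepFun U μ)
    {𝒞 : Set ℝ} (hW𝕎 : ∀ᵐ ω ∂P, M.W ω ∈ 𝕎) (hC𝒞 : ∀ᵐ ω ∂P, M.C ω ∈ 𝒞)
    {κ : Kernel (ℝ × ℝ) Ω} [IsMarkovKernel κ]
    (hκ : IsRegularCondProb P (fun ω => (M.W ω, M.C ω)) κ) {η : Kernel ℝ Ω} [IsMarkovKernel η]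
    (hη : IsRegularCondProb P M.C η) (hcons : Consistency M 𝕎) {δ : ℕ → ℝ}
    (hδ : Tendsto δ atTop (𝓝 0)) (hδpos : ∀ᶠ N in atTop, 0 < δ N)
    (hunconf : ∀ᶠ N in atTop, LocalWeakUnconfoundedness M 𝕎 𝒞 κ η (δ N)) {q : ℝ} {K L : NNReal}
    (hK : ∀ c ∈ 𝒞, LipschitzOnWith K (fun w => condCDFAt M κ q w c) 𝕎) {w : ℝ} (hw : w ∈ 𝕎)
    (hL : LipschitzOnWith L (fun c => condCDFAt M κ q w c) 𝒞)
    (hgood : ∀ h > 0, Tendsto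
      (fun N => μ {s | ¬ GoodMatching M (fun j => U j s) N (δ N) w h}) atTop (𝓝 0)) :
    TendstoInMeasure μ (fun N s => matchedCDF M (fun j => U j s) N (δ N) w q) atTop
      (fun _ => potCDF P M w q) := by
  rw [tendstoInMeasure_iff_norm]
  intro ε hε
  have mY : Measurable (M.Y w) := M.measurable_Y.comp measurable_prodMk_left
  have hA : MeasurableSet {ω | M.Yobs ω ≤ q} := measurableSet_le M.measurable_Yobs measurable_const
  have hA' : MeasurableSet {ω | M.Y w ω ≤ q} := measurableSet_le mY measurable_const
  have hres := tendsto_measure_matched_residual hU hlaw hind hκ hA hgood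
    (show 0 < ε / 4 by positivity)
  have havg := tendstoInMeasure_iff_norm.1 (tendstoInMeasure_average hU hlaw hind
    (g := fun ω => (η (M.C ω)).real {ω' | M.Y w ω' ≤ q}) (b := 1)
    ((measurable_kernel_real η hA').comp M.measurable_C)
    fun ω => by rw [abs_of_nonneg measureReal_nonneg]; exact measureReal_le_one)
    (ε / 4) (by positivity)
  rw [integral_kernel_real_eq_potCDF hη] at havg
  -- Error budget: residual, sampling average and matching discrepancy take `ε / 4` each, the last
  -- split evenly between exposure and covariate. Using `L + 1` avoids dividing by zero.
  have hLpos : (0 : ℝ) < 8 * (L + 1) := by positivity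
  have hgood' := hgood (ε / (8 * (L + 1))) (by positivity)
  have hae : ∀ᵐ ω ∂P, M.W ω ∈ 𝕎 ∧ M.C ω ∈ 𝒞 ∧
      (κ (M.W ω, M.C ω)).real {ω' | M.Yobs ω' ≤ q} = condCDFAt M κ q (M.W ω) (M.C ω) := by
    filter_upwards [hW𝕎, hC𝒞, ae_kernel_real_eq_condCDFAt hκ hcons q] with ω h1 h2 h3
    exact ⟨h1, h2, h3 h1⟩
  have hnull := tendsto_measure_not_of_ae (ae_forall_sample hU hlaw hae)
  refine tendsto_measure_zero_of_subset (tendsto_measure_union_zero (tendsto_measure_union_zero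
    hres havg) (tendsto_measure_union_zero hgood' hnull)) ?_
  have hδK : Tendsto (fun N => K * δ N) atTop (𝓝 0) := by simpa using hδ.const_mul (K : ℝ)
  filter_upwards [hunconf, hδpos, hδK.eventually (gt_mem_nhds (show 0 < ε / 8 by positivity)),
    eventually_gt_atTop 0] with N hN hδN hKN hN0 s hs
  by_contra hcon
  simp only [mem_union, mem_ofPred_eq, not_or, not_le, not_not] at hcon
  obtain ⟨⟨h1, h2⟩, h3, h4⟩ := hcon
  have hclose := abs_sum_matchCount_sub_le (M := M) (x := fun j => U j s) (δ := δ N) (w := w)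
    hN0 (r := ε / 4)
    (g := fun j => (κ (M.W (U j s), M.C (U j s))).real {ω' | M.Yobs ω' ≤ q})
    (g' := fun i => (η (M.C (U i s))).real {ω' | M.Y w ω' ≤ q}) h3.exists_match (by
      intro i hi j hij
      rw [(h4 j).2.2, ← hN.condCDFAt_eq hδN.le hw (h4 i).2.1]
      refine (abs_condCDFAt_sub_le hK hw hL (h4 j).1 (h4 i).2.1 (h4 j).2.1).trans ?_
      have hW := (mem_caliperSet.1 hij.1).2
      have hW' : |M.W (U j s) - w| ≤ δ N := abs_le.2 ⟨by linarith [hW.1], by linarith [hW.2]⟩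
      have hC : |M.C (U j s) - M.C (U i s)| ≤ ε / (8 * (L + 1)) := h3.close i hi j hij
      have t1 : K * |M.W (U j s) - w| ≤ K * δ N := mul_le_mul_of_nonneg_left hW' K.2
      have t2 : L * |M.C (U j s) - M.C (U i s)| ≤ L * (ε / (8 * (L + 1))) :=
        mul_le_mul_of_nonneg_left hC L.2
      have t3 : L * (ε / (8 * (L + 1))) ≤ ε / 8 := by
        rw [← mul_div_assoc, div_le_div_iff₀ hLpos (by norm_num)]
        nlinarith [L.2]
      linarith)
  have hsplit : matchedCDF M (fun j => U j s) N (δ N) w q =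
      (∑ j ∈ Finset.range N, (matchCount M (fun j => U j s) N (δ N) w j : ℝ) / N *
        condResidual (fun ω => (M.W ω, M.C ω)) κ {ω | M.Yobs ω ≤ q} (U j s)) +
      ∑ j ∈ Finset.range N, (matchCount M (fun j => U j s) N (δ N) w j : ℝ) / N *
        (κ (M.W (U j s), M.C (U j s))).real {ω' | M.Yobs ω' ≤ q} := by
    rw [← Finset.sum_add_distrib]
    refine Finset.sum_congr rfl fun j _ => ?_
    rw [← mul_add, condResidual, sub_add_cancel]
    rfl
  have hs' : ε ≤ |matchedCDF M (fun j => U j s) N (δ N) w q - potCDF P M w q| := hs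
  rw [Real.norm_eq_abs] at h2
  rw [hsplit] at hs'
  have a1 := abs_lt.1 h1
  have a2 := abs_lt.1 h2
  have a3 := abs_le.1 hclose
  refine absurd hs' (not_le.2 (abs_lt.2 ⟨?_, ?_⟩)) <;> linarith [a1.1, a1.2, a2.1, a2.2, a3.1, a3.2]

end MatchedDistribution

/-! ### From the objective to the matched distribution function -/

section Estimator

variable {M : UnitModel Ω} {x : ℕ → Ω} {N : ℕ} {δ w τ : ℝ} {levels : Finset ℝ}

lemma objective_eq (hw : w ∈ levels)
    (hsep : ∀ v ∈ levels, ∀ v' ∈ levels, v ≠ v' → 2 * δ ≤ |v - v'|)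
    (h1 : ∀ j, M.W (x j) ≠ w - δ) (h2 : ∀ j, M.W (x j) ≠ w + δ) (q : ℝ) :
    objective M x N δ levels τ w q = ∑ j ∈ Finset.range N,
      (matchCount M x N δ w j : ℝ) / N * checkLoss τ (M.Yobs (x j) - q) := by
  rw [objective, Finset.mul_sum]
  refine (Finset.sum_congr rfl fun j hj => ?_).trans
    (Finset.sum_subset (fun j hj => Finset.mem_range.2 (mem_caliperSet.1 hj).1) fun j _ hj => ?_)
  · rw [replacementCount_eq hw hsep hj (h1 j) (h2 j)]
    ring
  · rw [matchCount_of_notMem hj]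
    simp

/-- A minimizer of the objective lies between `q₀` and `q₁` if the distribution function of the
matched sample is below `τ` at `q₀` and above `τ` at `q₁`. -/
lemma mem_Icc_of_isMinOn_objective (hN : 0 < N) (hw : w ∈ levels)
    (hsep : ∀ v ∈ levels, ∀ v' ∈ levels, v ≠ v' → 2 * δ ≤ |v - v'|)
    (h1 : ∀ j, M.W (x j) ≠ w - δ) (h2 : ∀ j, M.W (x j) ≠ w + δ)
    (hex : ∀ i < N, ∃ j, IsMatch M x N δ w i j) {r : ℝ}
    (hr : IsMinOn (objective M x N δ levels τ w) univ r) {q₀ q₁ : ℝ}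
    (hq₀ : matchedCDF M x N δ w q₀ < τ) (hq₁ : τ < matchedCDF M x N δ w q₁) : r ∈ Icc q₀ q₁ := by
  have hN' : (N : ℝ) ≠ 0 := Nat.cast_ne_zero.2 hN.ne'
  have hnonneg : ∀ j ∈ Finset.range N, 0 ≤ (matchCount M x N δ w j : ℝ) / N := fun j _ => by
    positivity
  have hsum : ∑ j ∈ Finset.range N, (matchCount M x N δ w j : ℝ) / N = 1 := by
    obtain ⟨j, hj⟩ := hex 0 hN
    choose m hm using exists_isMatch ⟨j, hj.1⟩
    have := sum_matchCount_mul (fun i _ => hm i) fun _ => 1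
    simp only [mul_one, Finset.sum_const, Finset.card_range, nsmul_eq_mul] at this
    rw [← Finset.sum_div, this, div_self hN']
  have hmin : ∀ q, ∑ j ∈ Finset.range N, (matchCount M x N δ w j : ℝ) / N *
      checkLoss τ (M.Yobs (x j) - r) ≤ ∑ j ∈ Finset.range N,
        (matchCount M x N δ w j : ℝ) / N * checkLoss τ (M.Yobs (x j) - q) := fun q => by
    rw [← objective_eq hw hsep h1 h2, ← objective_eq hw hsep h1 h2]
    exact hr (mem_univ q)
  exact ⟨le_of_sum_indicator_lt hnonneg hsum (hmin q₀) hq₀,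
    le_of_lt_sum_indicator hnonneg hsum (hmin q₁) hq₁⟩

end Estimator

end MatchingQuantile

/-! ### Trapping the estimator around the true quantile -/

theorem theorem1 {Ω : Type*} [MeasurableSpace Ω] (P : Measure Ω) [IsProbabilityMeasure P]
    (M : MatchingQuantile.UnitModel Ω)
    -- exposure levels, covariate support, interval of outcome values
    (𝕎 : Set ℝ) (h𝕎 : 𝕎.OrdConnected) (h𝕎' : 𝕎.Nontrivial)
    (c₀ c₁ : ℝ) (hc : c₀ < c₁) (a b : ℝ)
    -- the generalized propensity score, and the conditional laws given `(W, C)` and given `C`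
    (e : ℝ → ℝ → ℝ) (he : MatchingQuantile.IsGPS P M 𝕎 e)
    (κ : Kernel (ℝ × ℝ) Ω) [IsMarkovKernel κ]
    (hκ : MatchingQuantile.IsRegularCondProb P (fun ω => (M.W ω, M.C ω)) κ)
    (η : Kernel ℝ Ω) [IsMarkovKernel η]
    (hη : MatchingQuantile.IsRegularCondProb P M.C η)
    -- calipers
    (δ : ℕ → ℝ)
    (hδ : δ =o[atTop] (fun N : ℕ => (N : ℝ) ^ (-(1 / 3) : ℝ)))
    (hNδ : Tendsto (fun N : ℕ => (N : ℝ) * δ N) atTop atTop)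
    -- assumptions on the population
    (h_cons : MatchingQuantile.Consistency M 𝕎)
    (h_over : MatchingQuantile.Overlap 𝕎 (Icc c₀ c₁) e)
    (h_unconf : ∀ᶠ N in atTop,
      MatchingQuantile.LocalWeakUnconfoundedness M 𝕎 (Icc c₀ c₁) κ η (δ N))
    (h_smooth : MatchingQuantile.Smoothness M 𝕎 (Icc c₀ c₁) (Icc a b) e κ)
    (h_cov : MatchingQuantile.CovariateRegularity P M 𝕎 (Icc a b) c₀ c₁ κ)
    -- the exposure level and the quantile level
    (w : ℝ) (hw : w ∈ 𝕎) (τ : ℝ) (hτ : τ ∈ Ioo (0 : ℝ) 1)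
    (h_out : MatchingQuantile.OutcomeRegularity P M w a b)
    (h_q : MatchingQuantile.qerf P M τ w ∈ Ioo a b)
    -- an i.i.d. sample of units
    {S : Type*} [MeasurableSpace S] (μ : Measure S) [IsProbabilityMeasure μ]
    (U : ℕ → S → Ω) (hU : ∀ j, Measurable (U j)) (hU_law : ∀ j, μ.map (U j) = P)
    (hU_indep : iIndepFun U μ)
    -- the exposure levels used in the matching: `w` is one of them, and the bins do not overlap
    (levels : ℕ → Finset ℝ) (hlevels : ∀ N, w ∈ levels N)
    (hlevels' : ∀ N, ∀ v ∈ levels N, ∀ v' ∈ levels N, v ≠ v' → 2 * δ N ≤ |v - v'|)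
    -- the matching estimator
    (qhat : ℕ → S → ℝ)
    (hqhat : ∀ N s, qhat N s ∈ {q | IsMinOn
      (MatchingQuantile.objective M (fun j => U j s) N (δ N) (levels N) τ w) univ q}) :
    TendstoInMeasure μ qhat atTop (fun _ => MatchingQuantile.qerf P M τ w) := by
  have hδ0 : Tendsto δ atTop (𝓝 0) := hδ.isBigO.trans_tendsto
    ((tendsto_rpow_neg_atTop (by norm_num : (0 : ℝ) < 1 / 3)).comp tendsto_natCast_atTop_atTop)
  have hδpos : ∀ᶠ N in atTop, 0 < δ N := by
    filter_upwards [hNδ.eventually_gt_atTop 0] with N hN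
    exact (pos_iff_pos_of_mul_pos hN).1
      (lt_of_le_of_ne (Nat.cast_nonneg N) fun h0 => by simp [← h0] at hN)
  obtain ⟨⟨f, -, hf, m, B, hm, hfmB⟩, hLip⟩ := h_cov
  have hgood : ∀ h > 0, Tendsto (fun N => μ {s | ¬ MatchingQuantile.GoodMatching M
      (fun j => U j s) N (δ N) w h}) atTop (𝓝 0) := fun h hh =>
    MatchingQuantile.tendsto_measure_not_goodMatching hU hU_law hU_indep h𝕎 h𝕎' hc he h_over hf hm
      (fun c hc => (hfmB c hc).1) (fun c hc => (hfmB c hc).2) hw hδ0 hNδ hh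
  have hcdf : ∀ q ∈ Icc a b, TendstoInMeasure μ
      (fun N s => MatchingQuantile.matchedCDF M (fun j => U j s) N (δ N) w q) atTop
      (fun _ => MatchingQuantile.potCDF P M w q) := fun q hq => by
    obtain ⟨K, hK⟩ := h_smooth.2 q hq
    obtain ⟨L, hL⟩ := hLip q hq w hw
    exact MatchingQuantile.tendstoInMeasure_matchedCDF hU hU_law hU_indep
      (he.ae_mem h𝕎.measurableSet) (MatchingQuantile.ae_mem_of_map_eq_withDensity hf) hκ hη h_cons
      hδ0 hδpos h_unconf hK hw hL hgood
  rw [tendstoInMeasure_iff_norm]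
  intro ε hε
  set qτ := MatchingQuantile.qerf P M τ w
  obtain ⟨t, ht, htε, hta, htb⟩ : ∃ t, 0 < t ∧ t < ε ∧ a < qτ - t ∧ qτ + t < b := by
    have h1 := sub_pos.2 h_q.1
    have h2 := sub_pos.2 h_q.2
    refine ⟨min ε (min (qτ - a) (b - qτ)) / 2, by positivity, ?_, ?_, ?_⟩
    · linarith [min_le_left ε (min (qτ - a) (b - qτ))]
    · linarith [(min_le_right ε (min (qτ - a) (b - qτ))).trans (min_le_left _ _)]
    · linarith [(min_le_right ε (min (qτ - a) (b - qτ))).trans (min_le_right _ _)]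
  have hlo : MatchingQuantile.potCDF P M w (qτ - t) < τ :=
    MatchingQuantile.potCDF_lt_of_lt_qerf hτ.1 (by linarith)
  -- The weak inequality at `qτ + t / 2` becomes strict at `qτ + t` by strict monotonicity of `F_w`
  -- on `[a, b]`.
  have hhi : τ < MatchingQuantile.potCDF P M w (qτ + t) :=
    (MatchingQuantile.le_potCDF_of_qerf_lt hτ.2 (show qτ < qτ + t / 2 by linarith)).trans_lt
      (h_out.1 ⟨by linarith, by linarith⟩ ⟨by linarith, by linarith⟩ (by linarith))
  have h0 := tendstoInMeasure_iff_norm.1 (hcdf (qτ - t) ⟨by linarith, by linarith⟩) _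
    (sub_pos.2 hlo)
  have h1 := tendstoInMeasure_iff_norm.1 (hcdf (qτ + t) ⟨by linarith, by linarith⟩) _
    (sub_pos.2 hhi)
  -- Almost surely no unit sits on a window endpoint, for all of the countably many `N` at once.
  have hnull := MatchingQuantile.tendsto_measure_not_of_ae (ae_all_iff.2 fun N =>
    MatchingQuantile.ae_forall_sample hU hU_law
      ((he.ae_ne (w - δ N)).and (he.ae_ne (w + δ N))))
  -- Of the good matching only the existence of matches is needed here, so the choice `h = 1` is
  -- arbitrary.
  refine MatchingQuantile.tendsto_measure_zero_of_subset
    (MatchingQuantile.tendsto_measure_union_zero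
      (MatchingQuantile.tendsto_measure_union_zero h0 h1)
      (MatchingQuantile.tendsto_measure_union_zero (hgood 1 one_pos) hnull)) ?_
  filter_upwards [eventually_gt_atTop 0] with N hN s hs
  by_contra hcon
  simp only [mem_union, mem_ofPred_eq, not_or, not_le, not_not, Real.norm_eq_abs] at hcon
  obtain ⟨⟨c0, c1⟩, hg, hne⟩ := hcon
  have hmem := MatchingQuantile.mem_Icc_of_isMinOn_objective hN (hlevels N) (hlevels' N)
    (fun j => (hne N j).1) (fun j => (hne N j).2) hg.exists_match (hqhat N s)
    (q₀ := qτ - t) (q₁ := qτ + t) (by linarith [(abs_lt.1 c0).2]) (by linarith [(abs_lt.1 c1).1])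
  have hs' : ε ≤ |qhat N s - qτ| := hs
  have : |qhat N s - qτ| ≤ t := abs_le.2 ⟨by linarith [hmem.1], by linarith [hmem.2]⟩
  linarith
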